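/- Consider the two-dimensional AB flow $$v(x_1,x_2)=(-\sin x_1\sin x_2,\,-\cos x_1\cos x_2),$$ a smooth $2\pi$-periodic steady solution of the incompressible Euler equations $(v\cdot\nabla)v=-\nabla p$, $\nabla\cdot v=0$ (with smooth $2\pi$-periodic pressure). Let $\omega=\partial_1v_2-\partial_2v_1$ be its vorticity and $\hat f_p$, $p\in\mathbb Z^2$, denote Fourier coefficients. Then $\Gamma:=\sum_p|\hat\omega_p|=2$; let $T=\Gamma t$ be the dimensionless time. The flow has a unique Lagrangian map $X(a,t)$, defined by $\dot X=v(X)$, $X(a,0)=a$, for all $a\in\mathbb R^2$, $t\in\mathbb R$. Let $\xi^{(s)}(a)=\frac1{s!}\,\partial_t^s\big(X(a,t)-a\big)\big|_{t=0}$ be the time-Taylor coefficients of the displacement, and for $t\ge0$ let $$\zeta(t)=\sum_{s\ge1}\Big(\sum_{p}|p|\,|\hat\xi^{(s)}_p|\Big)t^s .$$ 1. The first two coefficients are $\xi^{(1)}(a)=(-\sin a_1\sin a_2,-\cos a_1\cos a_2)$ and $\xi^{(2)}(a)=\frac14(\sin2a_1,-\sin2a_2)$, with $\sum_p|p||\hat\xi^{(1)}_p|=2$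 and $\sum_p|p||\hat\xi^{(2)}_p|=1$. 2. Put $A(T)=T+T^2\big(\tfrac14-\tfrac1{\sqrt2}\big)$ and $$T_{AB}=\frac{2-\sqrt[4]{2}}{\sqrt8-1},\qquad |T_{AB}-0.4434|<5\cdot10^{-5}.$$ Then $T_{AB}$ is the least $T\ge0$ for which $A(T)-z+z^2/\sqrt2\ge0$ for all real $z$. For $0\le T<T_{AB}$ and $t=T/\Gamma$, the series $\zeta(t)$ converges, and $$A(T)-\zeta(t)+\frac{\zeta(t)^2}{\sqrt2}\ge0,\qquad \zeta(t)\le\frac{1-\sqrt{1-2\sqrt2\,A(T)}}{\sqrt2}.$$ 3. Analyticity is guaranteed up to the dimensionless time $T_{AB}$: for every $a$, the series $\sum_{s\ge1}\xi^{(s)}(a)t^s$ converges in the complex disk $\Gamma|t|<T_{AB}$ to an analytic function of $t$, which for real $t$ equals the displacement $X(a,t)-a$. 4. The exact dimensionless radius of convergence is $\pi$: the minimum over $a\in\mathbb R^2$ of $\Gamma R(a)$ is attained and equals $\pi$, where $R(a)\in(0,\infty]$ is the radius of convergence of $\sum_{s\ge1}\xi^{(s)}(a)t^s$. -/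

import Mathlib

open Real Set Metric
open scoped ENNReal ContDiff Nat

noncomputable section

namespace ABFlow

/-- The Euclidean plane, used for positions, velocities and displacements. -/
abbrev Plane := EuclideanSpace ℝ (Fin 2)

/-- The two-dimensional AB flow, with stream function `sin x₁ cos x₂`. -/
def velocity (x : Plane) : Plane :=
  !₂[-(sin (x 0) * sin (x 1)), -(cos (x 0) * cos (x 1))]

/-- `v` is a smooth, `2π`-periodic, time-independent solution of the incompressible Euler
equations `(v · ∇) v = -∇p`, `∇ · v = 0`, with a smooth `2π`-periodic pressure `p`. -/
def IsSteadyEulerSolution (v : Plane → Plane) : Prop :=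
  ContDiff ℝ ∞ v ∧
  (∀ x (i : Fin 2), v (x + EuclideanSpace.single i (2 * π)) = v x) ∧
  (∀ x, ∑ i : Fin 2, fderiv ℝ v x (EuclideanSpace.single i 1) i = 0) ∧
  ∃ p : Plane → ℝ, ContDiff ℝ ∞ p ∧
    (∀ x (i : Fin 2), p (x + EuclideanSpace.single i (2 * π)) = p x) ∧
    ∀ x, fderiv ℝ v x (v x) = -gradient p x

/-- The scalar vorticity `∂₁ v₂ - ∂₂ v₁`. -/
def vorticity (v : Plane → Plane) (x : Plane) : ℝ :=
  fderiv ℝ v x (EuclideanSpace.single 0 1) 1 - fderiv ℝ v x (EuclideanSpace.single 1 1) 0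

/-- `X a t` is the position at time `t` of the fluid particle that starts at `a`. -/
def IsLagrangianMap (v : Plane → Plane) (X : Plane → ℝ → Plane) : Prop :=
  ∀ a, X a 0 = a ∧ ∀ t, HasDerivAt (X a) (v (X a t)) t

/-- The `s`-th time-Taylor coefficient, at `t = 0`, of the displacement `X a t - a`. -/
def taylorCoeff (X : Plane → ℝ → Plane) (s : ℕ) (a : Plane) : Plane :=
  ((s ! : ℝ))⁻¹ • iteratedDeriv s (fun t => X a t - a) 0

/-- The time-Taylor series of the displacement of the particle that starts at `a`. -/
def taylorSeries (X : Plane → ℝ → Plane) (a : Plane) : FormalMultilinearSeries ℝ ℝ Plane :=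
  fun s => ContinuousMultilinearMap.mkPiRing ℝ (Fin s) (taylorCoeff X s a)

/-- The Fourier coefficient of index `p` of a function that is `2π`-periodic in both variables. -/
def fourierCoeff (f : Plane → ℂ) (p : Fin 2 → ℤ) : ℂ :=
  (1 / (2 * π) ^ 2 : ℂ) * ∫ y in (0 : ℝ)..2 * π, ∫ z in (0 : ℝ)..2 * π,
    Complex.exp (-Complex.I * (p 0 * y + p 1 * z)) * f !₂[y, z]

/-- A real vector, seen as a complex one. -/
def toComplex (x : Plane) : EuclideanSpace ℂ (Fin 2) :=
  WithLp.toLp 2 fun i => (x i : ℂ)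

/-- The (vector) Fourier coefficient of index `p` of a `2π`-periodic vector field. -/
def fourierCoeffVec (f : Plane → Plane) (p : Fin 2 → ℤ) : EuclideanSpace ℂ (Fin 2) :=
  WithLp.toLp 2 fun i => fourierCoeff (fun a => (f a i : ℂ)) p

/-- `∑_p |p| |f̂_p|`, with Euclidean norms of wave vectors and of Fourier coefficients. -/
def gradNorm (f : Plane → Plane) : ℝ≥0∞ :=
  ∑' p : Fin 2 → ℤ, ‖(WithLp.toLp 2 fun i => (p i : ℝ) : Plane)‖ₑ * ‖fourierCoeffVec f p‖ₑ

/-- `Γ = ∑_p |ω̂_p|`, for the vorticity `ω` of `v`. The dimensionless time is `T = Γ t`. -/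
def vorticityNorm (v : Plane → Plane) : ℝ≥0∞ :=
  ∑' p : Fin 2 → ℤ, ‖fourierCoeff (fun a => (vorticity v a : ℂ)) p‖ₑ

/-- The generating function `ζ(t) = ∑_{s ≥ 1} (∑_p |p| |ξ̂_p^(s)|) t ^ s`, for `t ≥ 0`. -/
def genFun (X : Plane → ℝ → Plane) (t : ℝ) : ℝ≥0∞ :=
  ∑' s : ℕ, gradNorm (taylorCoeff X (s + 1)) * ENNReal.ofReal t ^ (s + 1)

/-- The critical dimensionless time. -/
def criticalTime : ℝ := (2 - (2 : ℝ) ^ (1 / 4 : ℝ)) / (√8 - 1)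

/-- The part of the bounding polynomial that depends on the dimensionless time. -/
def timeTerm (T : ℝ) : ℝ := T + T ^ 2 * (1 / 4 - 1 / √2)

end ABFlow

end

/-! Along a trajectory put S = sin x₁, C = cos x₁, W = sin x₁ sin x₂. They satisfy S' = -C W, C' = S
W, W' = -S C, and x₁' = -W. The shifted exchange of coordinates (`IsTrajectory.swap`) reduces x₂ to
the same system. Both halves of the theorem rest on this.

Radius of convergence. The stream function c = sin x₁ cos x₂ is conserved, so S, C, W are Jacobi
elliptic functions of time with modulus k = √(1 - c²), up to a phase: S is dn, C is k sn, W is k cn.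
The addition theorem for cn at real plus imaginary time gives a formula for W in complex time, built
in the imaginary direction from the functions of modulus c. Its denominator is positive while the
cosine of their amplitude θ is. Since |θ(y)| ≤ |y|, this covers the strip |Im t| < π/2 for every
particle (`exists_holomorphic_velocity`), and the displacement is a primitive on the disk of radius
π/2. The bound is sharp: on a separatrix x₁' = 1 / cosh t, which has a pole at iπ/2
(`radius_separatrix_le`). With Γ = 2 the least dimensionless radius is π, well above the critical
time.

Generating function. The quadratic recursion keeps the n-th Taylor coefficients of S, C, W
trigonometric polynomials of degree n + 1 with coefficient sum at most 1
(`isTrigPoly_taylorAt_quadratic`). Integrating W in time divides by n + 1, which cancels the degree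
produced by the gradient, so every gradient norm is at most 2√2. With the exact values 2 and 1 of
the first two, ζ is at most the explicit `majorant`. This satisfies the quadratic inequality
(`quadratic_majorant_nonneg`) and, up to the critical time, stays left of the vertex of the
parabola, so the inequality passes down to ζ. -/

noncomputable section

namespace ABFlow

/-! ### Global flow: existence and uniqueness -/

/-- A bounded, globally Lipschitz, autonomous vector field has global integral curves. -/
theorem exists_global_solution {E : Type*} [NormedAddCommGroup E] [NormedSpace ℝ E]
    [CompleteSpace E] {f : E → E} {K L : NNReal} (hK : LipschitzWith K f)
    (hL : ∀ x, ‖f x‖ ≤ L) (a : E) :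
    ∃ X : ℝ → E, X 0 = a ∧ ∀ t, HasDerivAt X (f (X t)) t := by
  have key : ∀ n : ℕ, ∃ α : ℝ → E, α 0 = a ∧
      ∀ t ∈ Ioo (-(n : ℝ)) n, HasDerivAt α (f (α t)) t := by
    intro n
    have h0 : (0 : ℝ) ∈ Icc (-(n : ℝ)) n := by simp
    -- The bound L holds everywhere, so a ball of radius L n contains the solution for the whole
    -- window [-n, n].
    have hP : IsPicardLindelof (fun _ => f) (⟨0, h0⟩ : Icc (-(n : ℝ)) n) a (L * n) 0 L K :=
      { lipschitzOnWith := fun t _ => hK.lipschitzOnWith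
        continuousOn := fun x _ => continuousOn_const
        norm_le := fun t _ x _ => hL x
        mul_max_le := by simp }
    obtain ⟨α, h1, h2⟩ := hP.exists_eq_forall_mem_Icc_hasDerivWithinAt₀
    exact ⟨α, h1, fun t ht =>
      (h2 t (Ioo_subset_Icc_self ht)).hasDerivAt (Icc_mem_nhds ht.1 ht.2)⟩
  choose α h0 h using key
  have agree : ∀ m n : ℕ, m ≤ n → ∀ t ∈ Ioo (-(m : ℝ)) m, α m t = α n t := by
    intro m n hmn t ht
    have hmn' : (m : ℝ) ≤ n := by exact_mod_cast hmn
    have hm : (0 : ℝ) < m := by linarith [ht.1, ht.2]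
    exact ODE_solution_unique_of_mem_Ioo (v := fun _ => f) (s := fun _ => univ) (t₀ := 0)
      (fun _ _ => hK.lipschitzOnWith) ⟨by linarith, hm⟩ (fun t ht => ⟨h m t ht, trivial⟩)
      (fun t ht => ⟨h n t ⟨by linarith [ht.1], by linarith [ht.2]⟩, trivial⟩)
      (by rw [h0, h0]) ht
  have mem : ∀ t : ℝ, t ∈ Ioo (-((⌊|t|⌋₊ + 1 : ℕ) : ℝ)) ((⌊|t|⌋₊ + 1 : ℕ) : ℝ) := by
    intro t
    have := Nat.lt_floor_add_one |t|
    push_cast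
    exact abs_lt.1 this
  -- Glue the windows: the value at t comes from the window of half-width ⌊|t|⌋ + 1, and `agree`
  -- makes the choice immaterial near t.
  refine ⟨fun t => α (⌊|t|⌋₊ + 1) t, h0 _, fun t => ?_⟩
  refine (h _ t (mem t)).congr_of_eventuallyEq ?_
  filter_upwards [Ioo_mem_nhds (mem t).1 (mem t).2] with u hu
  rcases le_total (⌊|u|⌋₊ + 1) (⌊|t|⌋₊ + 1) with hle | hle
  · exact agree _ _ hle u (mem u)
  · exact (agree _ _ hle u hu).symm

theorem global_solution_unique {E : Type*} [NormedAddCommGroup E] [NormedSpace ℝ E]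
    {f : E → E} {K : NNReal} (hK : LipschitzWith K f) {X Y : ℝ → E}
    (hX : ∀ t, HasDerivAt X (f (X t)) t) (hY : ∀ t, HasDerivAt Y (f (Y t)) t)
    (h : X 0 = Y 0) : X = Y :=
  ODE_solution_unique_univ (v := fun _ => f) (s := fun _ => univ) (t₀ := 0)
    (fun _ => hK.lipschitzOnWith) (fun t => ⟨hX t, trivial⟩) (fun t => ⟨hY t, trivial⟩) h

theorem abs_sin_sub_sin_le (x y : ℝ) : |sin x - sin y| ≤ |x - y| := by
  simpa [Real.dist_eq] using Real.lipschitzWith_sin.dist_le_mul x y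

theorem abs_cos_sub_cos_le (x y : ℝ) : |cos x - cos y| ≤ |x - y| := by
  simpa [Real.dist_eq] using Real.lipschitzWith_cos.dist_le_mul x y

theorem abs_mul_sub_mul_le {a b c d p q : ℝ} (ha : |a| ≤ 1) (hd : |d| ≤ 1)
    (h1 : |a - c| ≤ p) (h2 : |b - d| ≤ q) : |a * b - c * d| ≤ p + q := by
  have : a * b - c * d = a * (b - d) + (a - c) * d := by ring
  rw [this]
  refine (abs_add_le _ _).trans ?_
  rw [abs_mul, abs_mul]
  nlinarith [abs_nonneg (a - c), abs_nonneg (b - d), abs_nonneg a, abs_nonneg d]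

theorem norm_plane_le (x : Plane) : ‖x‖ ≤ |x 0| + |x 1| := by
  rw [EuclideanSpace.norm_eq, Fin.sum_univ_two, Real.sqrt_le_left (by positivity)]
  simp only [Real.norm_eq_abs]
  nlinarith [abs_nonneg (x 0), abs_nonneg (x 1)]

theorem abs_coord_le (x : Plane) (i : Fin 2) : |x i| ≤ ‖x‖ := by
  simpa using PiLp.norm_apply_le x i

theorem velocity_lipschitz : LipschitzWith 4 velocity := by
  refine LipschitzWith.of_dist_le_mul fun x y => ?_
  rw [dist_eq_norm, dist_eq_norm]
  refine (norm_plane_le _).trans ?_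
  have h0 := abs_coord_le (x - y) 0
  have h1 := abs_coord_le (x - y) 1
  simp only [PiLp.sub_apply] at h0 h1
  have e0 : |velocity x 0 - velocity y 0| ≤ |x 0 - y 0| + |x 1 - y 1| := by
    have := abs_mul_sub_mul_le (abs_sin_le_one (x 0)) (abs_sin_le_one (y 1))
      (abs_sin_sub_sin_le (x 0) (y 0)) (abs_sin_sub_sin_le (x 1) (y 1))
    rw [abs_sub_comm] at this
    simpa [velocity, sub_eq_add_neg, add_comm] using this
  have e1 : |velocity x 1 - velocity y 1| ≤ |x 0 - y 0| + |x 1 - y 1| := by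
    have := abs_mul_sub_mul_le (abs_cos_le_one (x 0)) (abs_cos_le_one (y 1))
      (abs_cos_sub_cos_le (x 0) (y 0)) (abs_cos_sub_cos_le (x 1) (y 1))
    rw [abs_sub_comm] at this
    simpa [velocity, sub_eq_add_neg, add_comm] using this
  simp only [PiLp.sub_apply]
  norm_num
  linarith

theorem velocity_bounded (x : Plane) : ‖velocity x‖ ≤ (2 : NNReal) := by
  refine (norm_plane_le _).trans ?_
  have h0 : |velocity x 0| ≤ 1 := by
    simp only [velocity, PiLp.toLp_apply, Matrix.cons_val_zero, abs_neg, abs_mul]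
    exact mul_le_one₀ (abs_sin_le_one _) (abs_nonneg _) (abs_sin_le_one _)
  have h1 : |velocity x 1| ≤ 1 := by
    simp only [velocity, PiLp.toLp_apply, Matrix.cons_val_one, Matrix.cons_val_fin_one, abs_neg,
      abs_mul]
    exact mul_le_one₀ (abs_cos_le_one _) (abs_nonneg _) (abs_cos_le_one _)
  norm_num
  linarith

theorem exists_lagrangianMap : ∃ X, IsLagrangianMap velocity X := by
  choose X h0 h using exists_global_solution velocity_lipschitz velocity_bounded
  exact ⟨X, fun a => ⟨h0 a, h a⟩⟩

theorem lagrangianMap_unique {X Y : Plane → ℝ → Plane} (hX : IsLagrangianMap velocity X)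
    (hY : IsLagrangianMap velocity Y) : Y = X :=
  funext fun a => global_solution_unique velocity_lipschitz (hY a).2 (hX a).2
    ((hY a).1.trans (hX a).1.symm)

/-! ### Jacobi amplitude -/

/-- The angle pair behind the Jacobi elliptic functions of modulus `c`: `θ` is the amplitude,
and `cos η` is the delta amplitude. -/
theorem exists_amplitude {c : ℝ} (hc : |c| ≤ 1) :
    ∃ θ η : ℝ → ℝ, θ 0 = 0 ∧ η 0 = 0 ∧ (∀ y, HasDerivAt θ (cos (η y)) y) ∧
      (∀ y, HasDerivAt η (c * cos (θ y)) y) ∧ (∀ y, sin (η y) = c * sin (θ y)) ∧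
      ∀ y, |θ y| ≤ |y| := by
  -- Keeping η as a second unknown replaces θ' = √(1 - c² sin² θ) by a bounded system that is
  -- globally Lipschitz, including at |c| = 1.
  let f : ℝ × ℝ → ℝ × ℝ := fun x => (cos x.2, c * cos x.1)
  have hK : LipschitzWith 1 f := by
    refine LipschitzWith.of_dist_le_mul fun x y => ?_
    simp only [f, Prod.dist_eq, Real.dist_eq, NNReal.coe_one, one_mul]
    refine max_le ((abs_cos_sub_cos_le _ _).trans (le_max_right _ _)) ?_
    rw [← mul_sub, abs_mul]
    refine le_trans ?_ (le_max_left _ _)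
    calc |c| * |cos x.1 - cos y.1| ≤ 1 * |cos x.1 - cos y.1| := by gcongr
      _ ≤ _ := by rw [one_mul]; exact abs_cos_sub_cos_le _ _
  have hL : ∀ x, ‖f x‖ ≤ (1 : NNReal) := by
    intro x
    simp only [f, Prod.norm_def, Real.norm_eq_abs, NNReal.coe_one, abs_mul]
    exact max_le (abs_cos_le_one _) (mul_le_one₀ hc (abs_nonneg _) (abs_cos_le_one _))
  obtain ⟨X, h0, h⟩ := exists_global_solution hK hL (0, 0)
  have h1 : ∀ y, HasDerivAt (fun y => (X y).1) (cos (X y).2) y := fun y => (h y).fst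
  have h2 : ∀ y, HasDerivAt (fun y => (X y).2) (c * cos (X y).1) y := fun y => (h y).snd
  refine ⟨fun y => (X y).1, fun y => (X y).2, by simp [h0], by simp [h0], h1, h2, ?_, ?_⟩
  · intro y
    have hd : ∀ y, HasDerivAt (fun y => sin (X y).2 - c * sin (X y).1) 0 y := by
      intro y
      have := ((h2 y).sin).sub ((h1 y).sin.const_mul c)
      rwa [show cos (X y).2 * (c * cos (X y).1) - c * (cos (X y).1 * cos (X y).2) = 0 by ring]
        at this
    have := is_const_of_deriv_eq_zero (fun y => (hd y).differentiableAt)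
      (fun y => (hd y).deriv) y 0
    simp only [h0, sin_zero, mul_zero, sub_zero] at this
    linarith
  · intro y
    have := Convex.norm_image_sub_le_of_norm_hasDerivWithin_le (s := univ) (C := 1)
      (fun x _ => (h1 x).hasDerivWithinAt) (fun x _ => by
        simpa using abs_cos_le_one _) convex_univ (mem_univ (0 : ℝ)) (mem_univ y)
    simpa [h0] using this

/-! ### Euler equations and vorticity -/

theorem hasFDerivAt_coord (i : Fin 2) (x : Plane) :
    HasFDerivAt (fun x : Plane => x i) (EuclideanSpace.proj i : Plane →L[ℝ] ℝ) x :=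
  (EuclideanSpace.proj i : Plane →L[ℝ] ℝ).hasFDerivAt

theorem contDiff_coord (i : Fin 2) : ContDiff ℝ ∞ (fun x : Plane => x i) :=
  (EuclideanSpace.proj i : Plane →L[ℝ] ℝ).contDiff

theorem contDiff_velocity : ContDiff ℝ ∞ velocity := by
  rw [contDiff_euclidean]
  have h0 := contDiff_coord 0
  have h1 := contDiff_coord 1
  intro i
  fin_cases i
  · simpa [velocity] using ((h0.sin).mul h1.sin).neg
  · simpa [velocity] using ((h0.cos).mul h1.cos).neg

theorem fderiv_apply_coord {v : Plane → Plane} {x : Plane} (h : DifferentiableAt ℝ v x)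
    (w : Plane) (i : Fin 2) : fderiv ℝ v x w i = fderiv ℝ (fun x => v x i) x w := by
  have := ((EuclideanSpace.proj i : Plane →L[ℝ] ℝ).hasFDerivAt.comp x h.hasFDerivAt).fderiv
  exact (congrArg (fun L : Plane →L[ℝ] ℝ => L w) this).symm

theorem fderiv_velocity_zero (x w : Plane) : fderiv ℝ velocity x w 0 =
    -(cos (x 0) * sin (x 1) * w 0 + sin (x 0) * cos (x 1) * w 1) := by
  rw [fderiv_apply_coord (contDiff_velocity.differentiable (by simp) x)]
  have := (((hasFDerivAt_coord 0 x).sin).mul (hasFDerivAt_coord 1 x).sin).neg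
  have h2 : HasFDerivAt (fun x => velocity x 0) _ x := this
  rw [h2.fderiv]
  simp
  ring

theorem fderiv_velocity_one (x w : Plane) : fderiv ℝ velocity x w 1 =
    sin (x 0) * cos (x 1) * w 0 + cos (x 0) * sin (x 1) * w 1 := by
  rw [fderiv_apply_coord (contDiff_velocity.differentiable (by simp) x)]
  have := (((hasFDerivAt_coord 0 x).cos).mul (hasFDerivAt_coord 1 x).cos).neg
  have h2 : HasFDerivAt (fun x => velocity x 1) _ x := this
  rw [h2.fderiv]
  simp
  ring

theorem vorticity_velocity (x : Plane) : vorticity velocity x = 2 * (sin (x 0) * cos (x 1)) := by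
  rw [vorticity, fderiv_velocity_zero, fderiv_velocity_one]
  simp
  ring

theorem isSteadyEulerSolution_velocity : IsSteadyEulerSolution velocity := by
  refine ⟨contDiff_velocity, ?_, ?_, fun x => (cos (2 * x 0) - cos (2 * x 1)) / 4, ?_, ?_, ?_⟩
  · intro x i
    fin_cases i <;> ext j <;> fin_cases j <;> simp [velocity]
  · intro x
    rw [Fin.sum_univ_two, fderiv_velocity_zero, fderiv_velocity_one]
    simp
  · exact (((contDiff_const.mul (contDiff_coord 0)).cos).sub
      ((contDiff_const.mul (contDiff_coord 1)).cos)).div_const _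
  · intro x i
    have h : ∀ y : ℝ, cos (2 * (y + 2 * π)) = cos (2 * y) := fun y => by
      rw [show 2 * (y + 2 * π) = 2 * y + 2 * π + 2 * π by ring, cos_add_two_pi, cos_add_two_pi]
    fin_cases i <;> simp [h]
  · intro x
    have hg : HasGradientAt (fun x : Plane => (cos (2 * x 0) - cos (2 * x 1)) / 4)
        (!₂[-(sin (2 * x 0)) / 2, sin (2 * x 1) / 2]) x := by
      have := ((((hasFDerivAt_coord 0 x).const_mul 2).cos).sub
        (((hasFDerivAt_coord 1 x).const_mul 2).cos)).const_mul (1 / 4)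
      rw [hasGradientAt_iff_hasFDerivAt]
      have e : (fun x : Plane => (cos (2 * x 0) - cos (2 * x 1)) / 4) =
          fun x => 1 / 4 * (cos (2 * x 0) - cos (2 * x 1)) := by
        ext y
        ring
      rw [e]
      refine this.congr_fderiv ?_
      ext w
      simp [PiLp.inner_apply, Fin.sum_univ_two]
      ring
    rw [hg.gradient]
    ext j
    fin_cases j
    · change fderiv ℝ velocity x (velocity x) 0 = _
      rw [fderiv_velocity_zero]
      simp [velocity, sin_two_mul]
      linear_combination sin (x 0) * cos (x 0) * sin_sq_add_cos_sq (x 1)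
    · change fderiv ℝ velocity x (velocity x) 1 = _
      rw [fderiv_velocity_one]
      simp [velocity, sin_two_mul]
      linear_combination -(sin (x 1) * cos (x 1)) * sin_sq_add_cos_sq (x 0)

/-! ### Particle trajectories -/

/-- A pair of real functions that solve the particle equations of the AB flow. -/
structure IsTrajectory (x y : ℝ → ℝ) : Prop where
  fst : ∀ t, HasDerivAt x (-(sin (x t) * sin (y t))) t
  snd : ∀ t, HasDerivAt y (-(cos (x t) * cos (y t))) t

/-- The symmetry of the AB flow that exchanges the two coordinates. -/
theorem IsTrajectory.swap {x y : ℝ → ℝ} (h : IsTrajectory x y) :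
    IsTrajectory (fun t => y t + π / 2) (fun t => x t + π / 2) where
  fst t := by
    have := (h.snd t).add_const (π / 2)
    simp only [sin_add_pi_div_two]
    rwa [mul_comm]
  snd t := by
    have := (h.fst t).add_const (π / 2)
    simp only [cos_add_pi_div_two, neg_mul_neg]
    rwa [mul_comm]

theorem IsLagrangianMap.isTrajectory {X : Plane → ℝ → Plane} (hX : IsLagrangianMap velocity X)
    (a : Plane) : IsTrajectory (fun t => X a t 0) (fun t => X a t 1) where
  fst t := (EuclideanSpace.proj 0 : Plane →L[ℝ] ℝ).hasFDerivAt.comp_hasDerivAt t ((hX a).2 t)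
  snd t := (EuclideanSpace.proj 1 : Plane →L[ℝ] ℝ).hasFDerivAt.comp_hasDerivAt t ((hX a).2 t)

namespace IsTrajectory

variable {x y : ℝ → ℝ}

theorem hasDerivAt_sin (h : IsTrajectory x y) (t : ℝ) :
    HasDerivAt (fun t => sin (x t)) (-(cos (x t) * (sin (x t) * sin (y t)))) t := by
  have := (h.fst t).sin
  rwa [mul_neg] at this

theorem hasDerivAt_cos (h : IsTrajectory x y) (t : ℝ) :
    HasDerivAt (fun t => cos (x t)) (sin (x t) * (sin (x t) * sin (y t))) t := by
  have := (h.fst t).cos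
  rwa [neg_mul_neg] at this

/-- The identity sin² + cos² = 1 in the second coordinate eliminates that coordinate, which closes
the quadratic system in S, C, W. -/
theorem hasDerivAt_sin_mul_sin (h : IsTrajectory x y) (t : ℝ) :
    HasDerivAt (fun t => sin (x t) * sin (y t)) (-(sin (x t) * cos (x t))) t := by
  have := (h.hasDerivAt_sin t).mul (h.snd t).sin
  refine this.congr_deriv ?_
  linear_combination -(sin (x t) * cos (x t)) * sin_sq_add_cos_sq (y t)

theorem contDiff_pair (h : IsTrajectory x y) : ContDiff ℝ ∞ x ∧ ContDiff ℝ ∞ y := by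
  rw [contDiff_infty, contDiff_infty, ← forall_and]
  intro n
  induction n with
  | zero =>
    simp only [CharP.cast_eq_zero, contDiff_zero]
    exact ⟨continuous_iff_continuousAt.2 fun t => (h.fst t).continuousAt,
      continuous_iff_continuousAt.2 fun t => (h.snd t).continuousAt⟩
  | succ n ih =>
    have d0 : deriv x = fun t => -(sin (x t) * sin (y t)) := funext fun t => (h.fst t).deriv
    have d1 : deriv y = fun t => -(cos (x t) * cos (y t)) := funext fun t => (h.snd t).deriv
    push_cast
    rw [contDiff_succ_iff_deriv, contDiff_succ_iff_deriv, d0, d1]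
    exact ⟨⟨fun t => (h.fst t).differentiableAt, by simp, (ih.1.sin.mul ih.2.sin).neg⟩,
      ⟨fun t => (h.snd t).differentiableAt, by simp, (ih.1.cos.mul ih.2.cos).neg⟩⟩

end IsTrajectory

/-! ### Continuation to the strip of half-width π/2 -/

theorem hasDerivAt_of_cauchyRiemann {u v : ℂ → ℝ} {p q : ℝ} {z : ℂ}
    (hu : HasFDerivAt u (p • Complex.reCLM - q • Complex.imCLM) z)
    (hv : HasFDerivAt v (q • Complex.reCLM + p • Complex.imCLM) z) :
    HasDerivAt (fun z => (u z : ℂ) + v z * Complex.I) (p + q * Complex.I) z := by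
  have h1 := (Complex.ofRealCLM.hasFDerivAt.comp z hu).add
    ((Complex.ofRealCLM.hasFDerivAt.comp z hv).mul_const Complex.I)
  rw [hasDerivAt_iff_hasFDerivAt]
  refine hasFDerivAt_of_restrictScalars ℝ h1 ?_
  ext w
  apply Complex.ext
  · simp
    ring
  · simp
    ring

/-- Cauchy-Riemann equations for a quotient of sums of products of a function of the real part
and a function of the imaginary part. -/
theorem differentiableAt_of_cauchyRiemann_quotient {W B E f g h : ℝ → ℝ}
    {W' B' E' f' g' h' k' : ℝ} {z : ℂ}
    (hW : HasDerivAt W W' z.re) (hB : HasDerivAt B B' z.re) (hE : HasDerivAt E E' z.re)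
    (hf : HasDerivAt f f' z.im) (hg : HasDerivAt g g' z.im) (hh : HasDerivAt h h' z.im)
    (hk : HasDerivAt (fun y => f y ^ 2) k' z.im)
    (hD : f z.im ^ 2 + E z.re * h z.im ≠ 0)
    (h1 : W' * f z.im * (f z.im ^ 2 + E z.re * h z.im) - W z.re * f z.im * (E' * h z.im) =
      -(B z.re * g' * (f z.im ^ 2 + E z.re * h z.im) - B z.re * g z.im * (k' + E z.re * h')))
    (h2 : W z.re * f' * (f z.im ^ 2 + E z.re * h z.im) - W z.re * f z.im * (k' + E z.re * h') =
      B' * g z.im * (f z.im ^ 2 + E z.re * h z.im) - B z.re * g z.im * (E' * h z.im)) :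
    DifferentiableAt ℂ (fun z : ℂ =>
      ((W z.re * f z.im / (f z.im ^ 2 + E z.re * h z.im) : ℝ) : ℂ) +
        ((-(B z.re * g z.im / (f z.im ^ 2 + E z.re * h z.im)) : ℝ) : ℂ) * Complex.I) z := by
  have re : ∀ {k : ℝ → ℝ} {k' : ℝ}, HasDerivAt k k' z.re →
      HasFDerivAt (fun z : ℂ => k z.re) (k' • Complex.reCLM) z :=
    fun hk => hk.comp_hasFDerivAt z Complex.reCLM.hasFDerivAt
  have im : ∀ {k : ℝ → ℝ} {k' : ℝ}, HasDerivAt k k' z.im →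
      HasFDerivAt (fun z : ℂ => k z.im) (k' • Complex.imCLM) z :=
    fun hk => hk.comp_hasFDerivAt z Complex.imCLM.hasFDerivAt
  have hDD := (im hk).add ((re hE).mul (im hh))
  set D := f z.im ^ 2 + E z.re * h z.im with hDdef
  have hinv := (hasDerivAt_inv hD).comp_hasFDerivAt z hDD
  -- Here p and q are the derivatives of the two parts in the real direction; `h2` and `h1`, divided
  -- by the square of the denominator, identify the derivatives in the imaginary direction with -q
  -- and p.
  refine (hasDerivAt_of_cauchyRiemann
    (p := W' * f z.im * D⁻¹ - W z.re * f z.im * (E' * h z.im) * (D ^ 2)⁻¹)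
    (q := -(B' * g z.im * D⁻¹ - B z.re * g z.im * (E' * h z.im) * (D ^ 2)⁻¹))
    ?_ ?_).differentiableAt
  · have := ((re hW).mul (im hf)).mul hinv
    simp only [div_eq_mul_inv]
    refine this.congr_fderiv ?_
    have e2 : -(B' * g z.im * D⁻¹ - B z.re * g z.im * (E' * h z.im) * (D ^ 2)⁻¹) =
        -(W z.re * f' * D⁻¹ - W z.re * f z.im * (k' + E z.re * h') * (D ^ 2)⁻¹) := by
      field_simp
      linear_combination h2
    rw [e2]
    ext w
    simp [← hDdef]
    ring
  · have := (((re hB).mul (im hg)).mul hinv).neg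
    simp only [div_eq_mul_inv]
    refine this.congr_fderiv ?_
    have e2 : W' * f z.im * D⁻¹ - W z.re * f z.im * (E' * h z.im) * (D ^ 2)⁻¹ =
        -(B z.re * g' * D⁻¹ - B z.re * g z.im * (k' + E z.re * h') * (D ^ 2)⁻¹) := by
      field_simp
      linear_combination h1
    rw [e2]
    ext w
    simp [← hDdef]
    ring

namespace IsTrajectory

variable {x y : ℝ → ℝ}

theorem streamFunction_eq (h : IsTrajectory x y) (t : ℝ) :
    sin (x t) * cos (y t) = sin (x 0) * cos (y 0) := by
  have hd : ∀ t, HasDerivAt (fun t => sin (x t) * cos (y t)) 0 t := by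
    intro t
    refine ((h.fst t).sin.mul (h.snd t).cos).congr_deriv ?_
    ring
  exact is_const_of_deriv_eq_zero (fun t => (hd t).differentiableAt) (fun t => (hd t).deriv) t 0

/-- The first velocity component along a trajectory extends holomorphically to the strip
`|Im z| < π / 2`. -/
theorem exists_holomorphic_velocity (h : IsTrajectory x y) :
    ∃ G : ℂ → ℂ, (∀ z : ℂ, |z.im| < π / 2 → DifferentiableAt ℂ G z) ∧
      ∀ t : ℝ, G t = ((-(sin (x t) * sin (y t)) : ℝ) : ℂ) := by
  set c := sin (x 0) * cos (y 0) with hc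
  have hc1 : |c| ≤ 1 := by
    rw [hc, abs_mul]
    exact mul_le_one₀ (abs_sin_le_one _) (abs_nonneg _) (abs_cos_le_one _)
  obtain ⟨θ, η, hθ0, hη0, hθ, hη, hs, hle⟩ := exists_amplitude hc1
  -- This is the addition theorem for k cn at u + iv, with sin θ, cos θ, cos η as sn, cn, dn of
  -- modulus c at v. The phase of the trajectory never enters, because the factors at u are the
  -- trajectory's own C, W, S.
  have key : ∀ z : ℂ, |z.im| < π / 2 → DifferentiableAt ℂ (fun z : ℂ =>
      (((sin (x z.re) * sin (y z.re)) * cos (θ z.im) /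
        (cos (θ z.im) ^ 2 + cos (x z.re) ^ 2 * sin (θ z.im) ^ 2) : ℝ) : ℂ) +
        ((-((cos (x z.re) * sin (x z.re)) * (sin (θ z.im) * cos (η z.im)) /
          (cos (θ z.im) ^ 2 + cos (x z.re) ^ 2 * sin (θ z.im) ^ 2)) : ℝ) : ℂ) * Complex.I) z := by
    intro z hz
    have hcos : 0 < cos (θ z.im) := by
      have := abs_lt.1 ((hle z.im).trans_lt hz)
      exact cos_pos_of_mem_Ioo ⟨by linarith, by linarith⟩
    have hD : cos (θ z.im) ^ 2 + cos (x z.re) ^ 2 * sin (θ z.im) ^ 2 ≠ 0 := by positivity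
    have hDe : cos (θ z.im) ^ 2 + cos (x z.re) ^ 2 * sin (θ z.im) ^ 2 =
        1 - sin (x z.re) ^ 2 * sin (θ z.im) ^ 2 := by
      rw [cos_sq', cos_sq']; ring
    have r1 := sin_sq_add_cos_sq (x z.re)
    -- Conservation of the stream function ties the real side to the same c that is the modulus on
    -- the imaginary side.
    have r2 : (sin (x z.re) * sin (y z.re)) ^ 2 = sin (x z.re) ^ 2 - c ^ 2 := by
      rw [hc, ← h.streamFunction_eq z.re, mul_pow, mul_pow, cos_sq']; ring
    have r3 := sin_sq_add_cos_sq (θ z.im)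
    have r4 : cos (η z.im) ^ 2 = 1 - c ^ 2 * sin (θ z.im) ^ 2 := by
      rw [cos_sq', hs]; ring
    have hsd := (hθ z.im).sin.mul (hη z.im).cos
    rw [hs] at hsd
    refine differentiableAt_of_cauchyRiemann_quotient (W := fun t => sin (x t) * sin (y t))
      (B := fun t => cos (x t) * sin (x t)) (E := fun t => cos (x t) ^ 2)
      (f := fun t => cos (θ t)) (g := fun t => sin (θ t) * cos (η t))
      (h := fun t => sin (θ t) ^ 2)
      (h.hasDerivAt_sin_mul_sin z.re)
      ((h.hasDerivAt_cos z.re).mul (h.hasDerivAt_sin z.re)) ((h.hasDerivAt_cos z.re).pow 2)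
      (hθ z.im).cos hsd ((hθ z.im).sin.pow 2) ((hθ z.im).cos.pow 2) hD ?_ ?_
    -- With the trigonometric values as free letters, each Cauchy-Riemann equation is a polynomial
    -- identity modulo the relations collected above.
    · generalize sin (y z.re) = w at *
      generalize sin (x z.re) = S at *
      generalize cos (x z.re) = C at *
      generalize sin (θ z.im) = e at *
      generalize cos (θ z.im) = f at *
      generalize cos (η z.im) = d at *
      norm_num
      linear_combination (C * S * f) * (-2 * e ^ 2 * r2 +
        (f ^ 2 + C ^ 2 * e ^ 2 + 2 * e ^ 2 * (1 - C ^ 2)) * r4 -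
        2 * e ^ 2 * (1 - c ^ 2 * e ^ 2) * r1 - 2 * c ^ 2 * e ^ 2 * hDe)
    · generalize sin (y z.re) = w at *
      generalize sin (x z.re) = S at *
      generalize cos (x z.re) = C at *
      generalize sin (θ z.im) = e at *
      generalize cos (θ z.im) = f at *
      generalize cos (η z.im) = d at *
      norm_num
      linear_combination (S * w * e * d) * (2 * (1 - C ^ 2) * r3 - (1 + S ^ 2 - C ^ 2) * hDe +
        ((1 - S ^ 2 * e ^ 2) - 2 * (1 - e ^ 2) + 2 * S ^ 2 * e ^ 2) * r1)
  refine ⟨_, fun z hz => (key z hz).neg, fun t => ?_⟩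
  simp [hθ0]

/-- The displacement along a trajectory extends holomorphically to the disk `|z| < π / 2`. -/
theorem exists_holomorphic_displacement (h : IsTrajectory x y) :
    ∃ F : ℂ → ℂ, DifferentiableOn ℂ F (ball 0 (π / 2)) ∧
      ∀ t : ℝ, |t| < π / 2 → F t = ((x t - x 0 : ℝ) : ℂ) := by
  obtain ⟨G, hG, hGr⟩ := h.exists_holomorphic_velocity
  have hGd : DifferentiableOn ℂ G (ball 0 (π / 2)) := fun z hz =>
    (hG z ((Complex.abs_im_le_norm z).trans_lt (by simpa using hz))).differentiableWithinAt
  obtain ⟨F, hF0, hF⟩ := hGd.isExactOn_ball.with_val_at 0 0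
  refine ⟨F, fun z hz => (hF z hz).differentiableAt.differentiableWithinAt, fun t ht => ?_⟩
  have hI : ∀ s ∈ Ioo (-(π / 2)) (π / 2),
      HasDerivAt (fun s : ℝ => F s - ((x s - x 0 : ℝ) : ℂ)) 0 s := by
    intro s hs
    have h1 := (hF s (by simpa using abs_lt.2 hs)).comp_ofReal
    have h2 := ((h.fst s).sub_const (x 0)).ofReal_comp
    rw [hGr] at h1
    exact (h1.sub h2).congr_deriv (sub_self _)
  have h0 : (0 : ℝ) ∈ Ioo (-(π / 2)) (π / 2) := by
    constructor <;> linarith [pi_pos]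
  -- The primitive and the real displacement have equal derivatives on the interval and both vanish
  -- at 0.
  have := (convex_Ioo (-(π / 2)) (π / 2)).is_const_of_fderivWithin_eq_zero (𝕜 := ℝ)
    (fun s hs => (hI s hs).differentiableAt.differentiableWithinAt)
    (fun s hs => by
      rw [fderivWithin_of_isOpen isOpen_Ioo hs]
      ext
      simpa using (hI s hs).deriv) h0 (abs_lt.1 ht)
  simp only [Complex.ofReal_zero, hF0, sub_self] at this
  exact (sub_eq_zero.1 this.symm)

end IsTrajectory

/-! ### Radius of convergence -/

/-- Identifies the real-time Taylor coefficients with those of the holomorphic extension. The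
induction must also carry holomorphy of the derivatives. -/
theorem iteratedDeriv_ofReal {F : ℂ → ℂ} {g : ℝ → ℝ} {R : ℝ}
    (hF : DifferentiableOn ℂ F (ball 0 R)) (hg : ∀ t : ℝ, |t| < R → F t = (g t : ℂ)) (n : ℕ) :
    ∀ t : ℝ, |t| < R → iteratedDeriv n F t = ((iteratedDeriv n g t : ℝ) : ℂ) := by
  have hmem : ∀ {t : ℝ}, |t| < R → (t : ℂ) ∈ ball (0 : ℂ) R := fun ht => by simpa using ht
  suffices h : DifferentiableOn ℂ (iteratedDeriv n F) (ball 0 R) ∧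
      ∀ t : ℝ, |t| < R → iteratedDeriv n F t = ((iteratedDeriv n g t : ℝ) : ℂ) from h.2
  induction n with
  | zero => simpa using ⟨hF, hg⟩
  | succ n ih =>
    rw [iteratedDeriv_succ, iteratedDeriv_succ]
    refine ⟨ih.1.deriv isOpen_ball, fun t ht => ?_⟩
    have h1 := (ih.1.differentiableAt (isOpen_ball.mem_nhds (hmem ht))).hasDerivAt.comp_ofReal
    have h2 : HasDerivAt (fun s : ℝ => ((iteratedDeriv n g s : ℝ) : ℂ))
        (deriv (iteratedDeriv n F) t) t := by
      refine h1.congr_of_eventuallyEq ?_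
      filter_upwards [(isOpen_lt continuous_abs continuous_const).mem_nhds ht] with s hs
      exact (ih.2 s hs).symm
    have h3 : HasDerivAt (iteratedDeriv n g) (deriv (iteratedDeriv n F) t).re t := by
      exact Complex.reCLM.hasFDerivAt.comp_hasDerivAt t h2
    have h4 := h3.ofReal_comp
    rw [h3.deriv]
    exact h2.unique h4

theorem sin_two_mul_arctan_exp (t : ℝ) : sin (2 * arctan (exp t)) = 1 / cosh t := by
  rw [sin_two_mul, sin_arctan, cos_arctan, cosh_eq, exp_neg]
  have := exp_pos t
  have h2 : (√(1 + exp t ^ 2)) ^ 2 = 1 + exp t ^ 2 := sq_sqrt (by positivity)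
  have h3 : 0 < √(1 + exp t ^ 2) := by positivity
  field_simp
  rw [h2]
  ring

namespace IsLagrangianMap

variable {X : Plane → ℝ → Plane}

theorem contDiff (hX : IsLagrangianMap velocity X) (a : Plane) : ContDiff ℝ ∞ (X a) := by
  rw [contDiff_euclidean]
  intro i
  fin_cases i
  · exact (hX.isTrajectory a).contDiff_pair.1
  · exact (hX.isTrajectory a).contDiff_pair.2

theorem taylorCoeff_apply (hX : IsLagrangianMap velocity X) (s : ℕ) (a : Plane) (i : Fin 2) :
    taylorCoeff X s a i = ((s ! : ℝ))⁻¹ * iteratedDeriv s (fun t => X a t i - a i) 0 := by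
  have hc : ContDiff ℝ s (fun t => X a t - a) :=
    ((hX.contDiff a).sub contDiff_const).of_le (by exact_mod_cast le_top)
  have := (EuclideanSpace.proj i : Plane →L[ℝ] ℝ).iteratedFDeriv_comp_left
    (x := (0 : ℝ)) hc.contDiffAt (i := s) le_rfl
  have h2 := congrArg (fun L => L fun _ => (1 : ℝ)) this
  simp only [taylorCoeff, PiLp.smul_apply, smul_eq_mul]
  congr 1
  exact h2.symm

theorem exists_holomorphic_coord (hX : IsLagrangianMap velocity X) (a : Plane) (i : Fin 2) :
    ∃ F : ℂ → ℂ, DifferentiableOn ℂ F (ball 0 (π / 2)) ∧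
      (∀ t : ℝ, |t| < π / 2 → F t = ((X a t i - a i : ℝ) : ℂ)) ∧
      ∀ z ∈ ball (0 : ℂ) (π / 2),
        HasSum (fun s : ℕ => z ^ s * (taylorCoeff X s a i : ℂ)) (F z) := by
  have h : ∃ F : ℂ → ℂ, DifferentiableOn ℂ F (ball 0 (π / 2)) ∧
      (∀ t : ℝ, |t| < π / 2 → F t = ((X a t i - a i : ℝ) : ℂ)) := by
    fin_cases i
    · obtain ⟨F, h1, h2⟩ := (hX.isTrajectory a).exists_holomorphic_displacement
      simp only [(hX a).1] at h2
      exact ⟨F, h1, h2⟩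
    -- The shift by π/2 in the symmetry cancels in the displacement.
    · obtain ⟨F, h1, h2⟩ := (hX.isTrajectory a).swap.exists_holomorphic_displacement
      simp only [(hX a).1, add_sub_add_right_eq_sub] at h2
      exact ⟨F, h1, h2⟩
  obtain ⟨F, h1, h2⟩ := h
  refine ⟨F, h1, h2, fun z hz => ?_⟩
  have := Complex.hasSum_taylorSeries_on_ball h1 hz
  rw [show (fun s : ℕ => z ^ s * (taylorCoeff X s a i : ℂ)) =
    fun n : ℕ => (n ! : ℂ)⁻¹ • (z - 0) ^ n • iteratedDeriv n F 0 from ?_]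
  · exact this
  funext s
  have h3 := iteratedDeriv_ofReal h1 h2 s 0 (by simpa using pi_pos)
  rw [Complex.ofReal_zero] at h3
  rw [h3, hX.taylorCoeff_apply]
  push_cast
  simp only [sub_zero, smul_eq_mul]
  ring

/-- At each r < π/2 both coordinate series converge, so their terms tend to 0, and so does the norm
of the vector terms. The bound does not depend on the particle because the strip does not depend on
c. -/
theorem le_radius (hX : IsLagrangianMap velocity X) (a : Plane) :
    ENNReal.ofReal (π / 2) ≤ (taylorSeries X a).radius := by
  refine ENNReal.le_of_forall_nnreal_lt fun r hr => ?_
  have hr' : (r : ℝ) < π / 2 := by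
    rw [← ENNReal.ofReal_coe_nnreal] at hr
    exact (ENNReal.ofReal_lt_ofReal_iff (by positivity)).1 hr
  have hmem : ((r : ℝ) : ℂ) ∈ ball (0 : ℂ) (π / 2) := by simpa using hr'
  obtain ⟨F0, -, -, h0⟩ := hX.exists_holomorphic_coord a 0
  obtain ⟨F1, -, -, h1⟩ := hX.exists_holomorphic_coord a 1
  refine FormalMultilinearSeries.le_radius_of_tendsto (l := 0) _ ?_
  have t0 := (h0 _ hmem).summable.tendsto_atTop_zero.norm
  have t1 := (h1 _ hmem).summable.tendsto_atTop_zero.norm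
  refine squeeze_zero (g := fun n => ‖((r : ℝ) : ℂ) ^ n * (taylorCoeff X n a 0 : ℂ)‖ +
    ‖((r : ℝ) : ℂ) ^ n * (taylorCoeff X n a 1 : ℂ)‖) (fun n => by positivity) (fun n => ?_) (by simpa using t0.add t1)
  rw [taylorSeries, ContinuousMultilinearMap.norm_mkPiRing]
  simp only [norm_mul, norm_pow, Complex.norm_real, Real.norm_eq_abs, NNReal.abs_eq]
  calc ‖taylorCoeff X n a‖ * (r : ℝ) ^ n
      ≤ (|taylorCoeff X n a 0| + |taylorCoeff X n a 1|) * (r : ℝ) ^ n := by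
        gcongr
        exact norm_plane_le _
    _ = _ := by ring

/-- The line x₂ = -π/2 is invariant since its cosine vanishes, and there the flow reduces to x₁' =
sin x₁, solved by 2 arctan(eᵗ). The orbit joins the stagnation points x₁ = 0 and x₁ = π. -/
theorem separatrix_eq (hX : IsLagrangianMap velocity X) (t : ℝ) :
    X (!₂[π / 2, -(π / 2)]) t = !₂[2 * arctan (exp t), -(π / 2)] := by
  have hd : ∀ t : ℝ, HasDerivAt (fun t => 2 * arctan (exp t)) (1 / cosh t) t := by
    intro t
    refine ((hasDerivAt_exp t).arctan.const_mul 2).congr_deriv ?_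
    rw [cosh_eq, exp_neg]
    have := exp_pos t
    field_simp
    ring
  have hY : ∀ t : ℝ, HasDerivAt (fun t => (!₂[2 * arctan (exp t), -(π / 2)] : Plane))
      (velocity (!₂[2 * arctan (exp t), -(π / 2)])) t := by
    intro t
    rw [← hasDerivWithinAt_univ, hasDerivWithinAt_iff_hasFDerivWithinAt,
      hasFDerivWithinAt_euclidean]
    intro i
    fin_cases i
    · refine ((hd t).hasDerivWithinAt.hasFDerivWithinAt).congr_fderiv ?_
      ext
      simp [velocity, sin_two_mul_arctan_exp]
    · refine ((hasDerivAt_const t (-(π / 2))).hasDerivWithinAt.hasFDerivWithinAt).congr_fderiv ?_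
      ext
      simp [velocity]
  have := global_solution_unique velocity_lipschitz (hX (!₂[π / 2, -(π / 2)])).2 hY (by
    rw [(hX _).1]
    simp
    ring)
  exact congrFun this t

/-- A larger radius would make the sum p of the first-coordinate series holomorphic across iπ/2. By
the identity theorem p' cosh = 1 would hold there, where cosh vanishes. -/
theorem radius_separatrix_le (hX : IsLagrangianMap velocity X) :
    (taylorSeries X (!₂[π / 2, -(π / 2)])).radius ≤ ENNReal.ofReal (π / 2) := by
  by_contra! hlt
  obtain ⟨r, hr1, hr2⟩ := ENNReal.lt_iff_exists_nnreal_btwn.1 hlt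
  set a : Plane := !₂[π / 2, -(π / 2)] with ha
  have hr : π / 2 < r := by
    rw [← ENNReal.ofReal_coe_nnreal] at hr1
    exact (ENNReal.ofReal_lt_ofReal_iff_of_nonneg (by positivity)).1 hr1
  have hpi := pi_pos
  have hsum := (taylorSeries X a).summable_norm_mul_pow hr2
  set p := FormalMultilinearSeries.ofScalars ℂ (fun s => (taylorCoeff X s a 0 : ℂ)) with hp
  have hrad : (r : ℝ≥0∞) ≤ p.radius := by
    refine FormalMultilinearSeries.le_radius_of_summable_norm _ (hsum.of_nonneg_of_le
      (fun n => by positivity) fun n => ?_)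
    gcongr
    rw [taylorSeries, ContinuousMultilinearMap.norm_mkPiRing, hp,
      FormalMultilinearSeries.ofScalars_norm]
    simpa using abs_coord_le (taylorCoeff X n a) 0
  have hr0 : 0 < (r : ℝ≥0∞) := by
    rw [ENNReal.coe_pos, ← NNReal.coe_pos]
    linarith
  have hH := (p.hasFPowerSeriesOnBall (hr0.trans_le hrad)).mono hr0 hrad
  have hHa := hH.analyticOnNhd
  rw [Metric.eball_coe] at hHa
  obtain ⟨F, hF1, hF2, hF3⟩ := hX.exists_holomorphic_coord a 0
  have hHF : ∀ t : ℝ, |t| < π / 2 → p.sum t = ((X a t 0 - a 0 : ℝ) : ℂ) := by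
    intro t ht
    have hmem : (t : ℂ) ∈ ball (0 : ℂ) (π / 2) := by simpa using ht
    rw [← hF2 t ht]
    have h1 := hH.hasSum (y := (t : ℂ)) (by
      rw [Metric.eball_coe]
      simpa using ht.trans hr)
    rw [zero_add] at h1
    refine h1.unique ?_
    simpa [hp, mul_comm] using hF3 t hmem
  have hd : ∀ t : ℝ, |t| < π / 2 → deriv p.sum t * Complex.cosh t - 1 = 0 := by
    intro t ht
    have h1 := iteratedDeriv_ofReal (n := 1)
      (hHa.differentiableOn.mono (ball_subset_ball hr.le)) hHF t ht
    have h2 : HasDerivAt (fun t => X a t 0 - a 0) (1 / cosh t) t := by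
      refine (((hX.isTrajectory a).fst t).sub_const _).congr_deriv ?_
      rw [ha, hX.separatrix_eq]
      simp [sin_two_mul_arctan_exp]
    rw [iteratedDeriv_one, iteratedDeriv_one, h2.deriv] at h1
    rw [h1]
    have := (cosh_pos t).ne'
    push_cast
    rw [one_div, inv_mul_cancel₀, sub_self]
    exact_mod_cast this
  have hfa : AnalyticOnNhd ℂ (fun z => deriv p.sum z * Complex.cosh z - 1) (ball 0 r) :=
    ((hHa.deriv).mul (Complex.differentiable_cosh.differentiableOn.analyticOnNhd isOpen_ball)).sub
      analyticOnNhd_const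
  have hfr : ∃ᶠ z in nhdsWithin (0 : ℂ) {0}ᶜ, deriv p.sum z * Complex.cosh z - 1 = 0 := by
    have ht : Filter.Tendsto (fun t : ℝ => (t : ℂ)) (nhdsWithin (0 : ℝ) {0}ᶜ)
        (nhdsWithin (0 : ℂ) {0}ᶜ) := by
      refine tendsto_nhdsWithin_iff.2 ⟨?_, ?_⟩
      · exact (Complex.continuous_ofReal.tendsto' 0 0 (by simp)).mono_left nhdsWithin_le_nhds
      · filter_upwards [self_mem_nhdsWithin] with t ht
        simpa using ht
    refine ht.frequently (Filter.Eventually.frequently ?_)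
    have : {t : ℝ | |t| < π / 2} ∈ nhdsWithin (0 : ℝ) {0}ᶜ :=
      mem_nhdsWithin_of_mem_nhds ((isOpen_lt continuous_abs continuous_const).mem_nhds
        (by simpa using hpi))
    filter_upwards [this] with t ht using hd t ht
  have hz := hfa.eqOn_zero_of_preconnected_of_frequently_eq_zero
    (convex_ball _ _).isPreconnected (mem_ball_self (by linarith)) hfr
  have hm : ((π / 2 : ℝ) : ℂ) * Complex.I ∈ ball (0 : ℂ) r := by
    simpa [abs_of_pos hpi] using hr
  have := hz hm
  simp [Complex.cosh_mul_I] at this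

end IsLagrangianMap

/-! ### Fourier coefficients of trigonometric sums -/

/-- The trigonometric monomial `exp (i p · a)`. -/
def trigMonomial (p : Fin 2 → ℤ) (a : Plane) : ℂ :=
  Complex.exp (Complex.I * (p 0 * a 0 + p 1 * a 1))

theorem integral_exp_int (n : ℤ) :
    ∫ y in (0 : ℝ)..2 * π, Complex.exp (Complex.I * n * y) = if n = 0 then 2 * (π : ℂ) else 0 := by
  split_ifs with h
  · simp [h]
  · have hn : Complex.I * n ≠ 0 := by simp [h]
    rw [integral_exp_mul_complex hn]
    have : Complex.exp (Complex.I * n * ((2 * π : ℝ) : ℂ)) = 1 :=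
      Complex.exp_eq_one_iff.2 ⟨n, by push_cast; ring⟩
    rw [this]
    simp

theorem fourierCoeff_sum {ι : Type*} [Fintype ι] {f : Plane → ℂ} {q : ι → Fin 2 → ℤ} {k : ι → ℂ}
    (hf : ∀ a, f a = ∑ i, k i * trigMonomial (q i) a) (p : Fin 2 → ℤ) :
    fourierCoeff f p = ∑ i, if q i = p then k i else 0 := by
  have h1 : ∀ y z : ℝ, Complex.exp (-Complex.I * (p 0 * y + p 1 * z)) * f (!₂[y, z]) =
      ∑ i, (k i * Complex.exp (Complex.I * ((q i 0 - p 0 : ℤ) : ℂ) * y)) *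
        Complex.exp (Complex.I * ((q i 1 - p 1 : ℤ) : ℂ) * z) := by
    intro y z
    rw [hf, Finset.mul_sum]
    refine Finset.sum_congr rfl fun i _ => ?_
    rw [mul_assoc, mul_left_comm, trigMonomial, ← Complex.exp_add, ← Complex.exp_add]
    congr 2
    simp
    ring
  have h2 : ∀ y : ℝ, ∫ z in (0 : ℝ)..2 * π,
      Complex.exp (-Complex.I * (p 0 * y + p 1 * z)) * f (!₂[y, z]) =
      ∑ i, (k i * if q i 1 - p 1 = 0 then 2 * (π : ℂ) else 0) *
        Complex.exp (Complex.I * ((q i 0 - p 0 : ℤ) : ℂ) * y) := by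
    intro y
    simp_rw [h1]
    rw [intervalIntegral.integral_finsetSum fun i _ =>
      Continuous.intervalIntegrable (by fun_prop) _ _]
    refine Finset.sum_congr rfl fun i _ => ?_
    rw [intervalIntegral.integral_const_mul, integral_exp_int]
    ring
  rw [fourierCoeff]
  simp_rw [h2]
  rw [intervalIntegral.integral_finsetSum fun i _ =>
    Continuous.intervalIntegrable (by fun_prop) _ _, Finset.mul_sum]
  refine Finset.sum_congr rfl fun i _ => ?_
  rw [intervalIntegral.integral_const_mul, integral_exp_int]
  have hpi : (π : ℂ) ≠ 0 := by exact_mod_cast pi_ne_zero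
  have hq : q i = p ↔ q i 0 - p 0 = 0 ∧ q i 1 - p 1 = 0 := by
    rw [funext_iff, Fin.forall_fin_two, sub_eq_zero, sub_eq_zero]
  by_cases h0 : q i 0 - p 0 = 0 <;> by_cases h3 : q i 1 - p 1 = 0
  · rw [if_pos h0, if_pos h3, if_pos (hq.2 ⟨h0, h3⟩)]
    field_simp
  all_goals
    rw [if_neg (c := q i = p) (by rw [hq]; tauto)]
    simp [h0, h3]

theorem tsum_ite_eq_sum {ι β : Type*} [Fintype ι] [DecidableEq β] (q : ι → β) (g : β → ι → ℝ≥0∞) :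
    ∑' p, ∑ i, (if q i = p then g p i else 0) = ∑ i, g (q i) i := by
  rw [Summable.tsum_finsetSum fun _ _ => ENNReal.summable]
  exact Finset.sum_congr rfl fun i _ => by simp

theorem sum_ite_injective {ι β A : Type*} [Fintype ι] [DecidableEq β] [AddCommMonoid A] {q : ι → β}
    (hq : Function.Injective q) (g : ι → A) (i : ι) :
    ∑ l, (if q l = q i then g l else 0) = g i := by
  rw [Finset.sum_eq_single i (fun l _ hl => if_neg (hq.ne hl)) (by simp), if_pos rfl]

/-- Wave vectors may repeat, so only the triangle inequality is available; an injective q gives the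
equalities that follow. -/
theorem tsum_mul_fourierCoeff_le {ι : Type*} [Fintype ι] {f : Plane → ℂ} {q : ι → Fin 2 → ℤ}
    {k : ι → ℂ} (hf : ∀ a, f a = ∑ i, k i * trigMonomial (q i) a) (w : (Fin 2 → ℤ) → ℝ≥0∞) :
    ∑' p, w p * ‖fourierCoeff f p‖ₑ ≤ ∑ i, w (q i) * ‖k i‖ₑ := by
  rw [← tsum_ite_eq_sum q fun p i => w p * ‖k i‖ₑ]
  refine ENNReal.tsum_le_tsum fun p => ?_
  rw [fourierCoeff_sum hf]
  calc w p * ‖∑ i, if q i = p then k i else 0‖ₑ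
      ≤ w p * ∑ i, ‖if q i = p then k i else 0‖ₑ := by gcongr; exact enorm_sum_le _ _
    _ = ∑ i, if q i = p then w p * ‖k i‖ₑ else 0 := by
      rw [Finset.mul_sum]
      refine Finset.sum_congr rfl fun i _ => ?_
      split_ifs <;> simp

theorem vorticityNorm_eq_sum {ι : Type*} [Fintype ι] {v : Plane → Plane} {q : ι → Fin 2 → ℤ}
    {k : ι → ℂ} (hq : Function.Injective q)
    (hf : ∀ a, (vorticity v a : ℂ) = ∑ i, k i * trigMonomial (q i) a) :
    vorticityNorm v = ∑ i, ‖k i‖ₑ := by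
  rw [vorticityNorm, ← tsum_ite_eq_sum q fun _ i => ‖k i‖ₑ]
  refine tsum_congr fun p => ?_
  rw [fourierCoeff_sum hf]
  by_cases h : ∃ i, q i = p
  · obtain ⟨i, rfl⟩ := h
    rw [sum_ite_injective hq, sum_ite_injective hq]
  · push Not at h
    simp [h]

theorem gradNorm_eq_sum {ι : Type*} [Fintype ι] {f : Plane → Plane} {q : ι → Fin 2 → ℤ}
    {k : ι → Fin 2 → ℂ} (hq : Function.Injective q)
    (hf : ∀ a j, (f a j : ℂ) = ∑ i, k i j * trigMonomial (q i) a) :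
    gradNorm f = ∑ i, ‖(WithLp.toLp 2 fun j => (q i j : ℝ) : Plane)‖ₑ *
      ‖(WithLp.toLp 2 (k i) : EuclideanSpace ℂ (Fin 2))‖ₑ := by
  rw [gradNorm, ← tsum_ite_eq_sum q fun p i => ‖(WithLp.toLp 2 fun j => (p j : ℝ) : Plane)‖ₑ *
    ‖(WithLp.toLp 2 (k i) : EuclideanSpace ℂ (Fin 2))‖ₑ]
  refine tsum_congr fun p => ?_
  by_cases h : ∃ i, q i = p
  · obtain ⟨i, rfl⟩ := h
    have : fourierCoeffVec f (q i) = WithLp.toLp 2 (k i) := by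
      ext j
      simp only [fourierCoeffVec, fourierCoeff_sum (fun a => hf a j)]
      exact sum_ite_injective hq (fun i => k i j) i
    rw [this]
    exact (sum_ite_injective hq (fun l => ‖(WithLp.toLp 2 fun j => (q i j : ℝ) : Plane)‖ₑ *
      ‖(WithLp.toLp 2 (k l) : EuclideanSpace ℂ (Fin 2))‖ₑ) i).symm
  · push Not at h
    have : fourierCoeffVec f p = 0 := by
      ext j
      simp [fourierCoeffVec, fourierCoeff_sum (fun a => hf a j), h]
    simp [this, h]

/-! ### Algebra of trigonometric polynomials -/

/-- `f` is a trigonometric polynomial of degree at most `d` in each variable whose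
coefficients have moduli of sum at most `M`. -/
def IsTrigPoly (d : ℕ) (M : ℝ) (f : Plane → ℝ) : Prop :=
  ∃ (ι : Type) (_ : Fintype ι) (q : ι → Fin 2 → ℤ) (k : ι → ℂ),
    (∀ a, (f a : ℂ) = ∑ i, k i * trigMonomial (q i) a) ∧ (∀ i j, |q i j| ≤ d) ∧ ∑ i, ‖k i‖ ≤ M

namespace IsTrigPoly

variable {d e : ℕ} {M N : ℝ} {f g : Plane → ℝ}

theorem nonneg (hf : IsTrigPoly d M f) : 0 ≤ M := by
  obtain ⟨ι, _, q, k, -, -, h⟩ := hf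
  exact (Finset.sum_nonneg fun i _ => norm_nonneg _).trans h

theorem mono {M' : ℝ} (hf : IsTrigPoly d M f) (h : M ≤ M') : IsTrigPoly d M' f := by
  obtain ⟨ι, _, q, k, h1, h2, h3⟩ := hf
  exact ⟨ι, _, q, k, h1, h2, h3.trans h⟩

/-- Indexing by pairs without collecting equal wave vectors makes degrees add and coefficient sums
multiply. -/
theorem mul (hf : IsTrigPoly d M f) (hg : IsTrigPoly e N g) :
    IsTrigPoly (d + e) (M * N) (fun a => f a * g a) := by
  have hM := hf.nonneg
  obtain ⟨ι, _, q, k, h1, h2, h3⟩ := hf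
  obtain ⟨κ, _, r, l, h4, h5, h6⟩ := hg
  refine ⟨ι × κ, inferInstance, fun i => q i.1 + r i.2, fun i => k i.1 * l i.2, ?_, ?_, ?_⟩
  · intro a
    push_cast
    rw [h1, h4, Finset.sum_mul_sum, Fintype.sum_prod_type]
    refine Finset.sum_congr rfl fun i _ => Finset.sum_congr rfl fun j _ => ?_
    rw [mul_mul_mul_comm, trigMonomial, trigMonomial, trigMonomial, ← Complex.exp_add]
    congr 2
    simp
    ring
  · intro i j
    push_cast
    exact (abs_add_le _ _).trans (add_le_add (h2 _ _) (h5 _ _))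
  · simp only [norm_mul]
    rw [Fintype.sum_prod_type]
    simp only [← Finset.sum_mul_sum]
    exact mul_le_mul h3 h6 (Finset.sum_nonneg fun i _ => norm_nonneg _) hM

theorem add (hf : IsTrigPoly d M f) (hg : IsTrigPoly d N g) :
    IsTrigPoly d (M + N) (fun a => f a + g a) := by
  obtain ⟨ι, _, q, k, h1, h2, h3⟩ := hf
  obtain ⟨κ, _, r, l, h4, h5, h6⟩ := hg
  refine ⟨ι ⊕ κ, inferInstance, Sum.elim q r, Sum.elim k l, ?_, ?_, ?_⟩
  · intro a
    push_cast
    rw [h1, h4, Fintype.sum_sum_type]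
    rfl
  · rintro (i | i) j
    · exact h2 i j
    · exact h5 i j
  · rw [Fintype.sum_sum_type]
    exact add_le_add h3 h6

theorem const_mul (hf : IsTrigPoly d M f) (c : ℝ) :
    IsTrigPoly d (|c| * M) (fun a => c * f a) := by
  obtain ⟨ι, _, q, k, h1, h2, h3⟩ := hf
  refine ⟨ι, inferInstance, q, fun i => c * k i, fun a => ?_, h2, ?_⟩
  · push_cast
    rw [h1, Finset.mul_sum]
    exact Finset.sum_congr rfl fun i _ => by ring
  · simp only [norm_mul, Complex.norm_real, Real.norm_eq_abs, ← Finset.mul_sum]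
    gcongr

theorem neg (hf : IsTrigPoly d M f) : IsTrigPoly d M (fun a => -f a) := by
  simpa using hf.const_mul (-1)

theorem sum_range {F : ℕ → Plane → ℝ} (n : ℕ) (h : ∀ i < n, IsTrigPoly d M (F i)) :
    IsTrigPoly d (n * M) (fun a => ∑ i ∈ Finset.range n, F i a) := by
  induction n with
  | zero => exact ⟨Empty, inferInstance, nofun, nofun, by simp, nofun, by simp⟩
  | succ n ih =>
    simp only [Finset.sum_range_succ]
    refine ((ih fun i hi => h i (hi.trans n.lt_succ_self)).add (h n n.lt_succ_self)).mono ?_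
    push_cast
    linarith

theorem exp_coord (i : Fin 2) (a : Plane) (n : ℤ) :
    trigMonomial (Pi.single i n) a = Complex.exp (n * a i * Complex.I) := by
  rw [trigMonomial]
  congr 1
  fin_cases i <;> simp <;> ring

theorem sin_coord (i : Fin 2) : IsTrigPoly 1 1 (fun a => sin (a i)) := by
  refine ⟨Bool, inferInstance, fun b => Pi.single i (if b then 1 else -1),
    fun b => if b then -Complex.I / 2 else Complex.I / 2, fun a => ?_, fun b j => ?_, ?_⟩
  · simp only [Fintype.sum_bool, exp_coord]
    push_cast
    rw [Complex.sin]
    simp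
    ring
  · by_cases h : j = i
    · subst h
      cases b <;> simp
    · simp [h]
  · simp
    norm_num

theorem cos_coord (i : Fin 2) : IsTrigPoly 1 1 (fun a => cos (a i)) := by
  refine ⟨Bool, inferInstance, fun b => Pi.single i (if b then 1 else -1),
    fun b => 1 / 2, fun a => ?_, fun b j => ?_, ?_⟩
  · simp only [Fintype.sum_bool, exp_coord]
    push_cast
    rw [Complex.cos]
    simp
    ring
  · by_cases h : j = i
    · subst h
      cases b <;> simp
    · simp [h]
  · simp

end IsTrigPoly

/-! ### Exact norms of the vorticity and of the first two coefficients -/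

/-- The wave vectors `(±1, ±1)`. -/
def diagonalModes : Fin 4 → Fin 2 → ℤ := ![![1, 1], ![1, -1], ![-1, 1], ![-1, -1]]

theorem diagonalModes_injective : Function.Injective diagonalModes := by
  decide

theorem abs_diagonalModes (i : Fin 4) (j : Fin 2) : |diagonalModes i j| = 1 := by
  revert i j
  decide

theorem sum_diagonalModes (k : Fin 4 → ℂ) (a : Plane) :
    ∑ i, k i * trigMonomial (diagonalModes i) a =
      k 0 * (Complex.exp (a 0 * Complex.I) * Complex.exp (a 1 * Complex.I)) +
      k 1 * (Complex.exp (a 0 * Complex.I) * Complex.exp (-a 1 * Complex.I)) +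
      k 2 * (Complex.exp (-a 0 * Complex.I) * Complex.exp (a 1 * Complex.I)) +
      k 3 * (Complex.exp (-a 0 * Complex.I) * Complex.exp (-a 1 * Complex.I)) := by
  simp only [Fin.sum_univ_four, trigMonomial, diagonalModes, ← Complex.exp_add]
  simp
  ring_nf

theorem sin_mul_sin_eq_sum (a : Plane) : ((sin (a 0) * sin (a 1) : ℝ) : ℂ) =
    ∑ i, (![-1 / 4, 1 / 4, 1 / 4, -1 / 4] : Fin 4 → ℂ) i * trigMonomial (diagonalModes i) a := by
  rw [sum_diagonalModes]
  push_cast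
  rw [Complex.sin, Complex.sin]
  simp
  ring_nf
  rw [Complex.I_sq]
  ring

theorem cos_mul_cos_eq_sum (a : Plane) : ((cos (a 0) * cos (a 1) : ℝ) : ℂ) =
    ∑ i, (![1 / 4, 1 / 4, 1 / 4, 1 / 4] : Fin 4 → ℂ) i * trigMonomial (diagonalModes i) a := by
  rw [sum_diagonalModes]
  push_cast
  rw [Complex.cos, Complex.cos]
  simp
  ring

theorem sin_mul_cos_eq_sum (a : Plane) : ((sin (a 0) * cos (a 1) : ℝ) : ℂ) =
    ∑ i, (![-Complex.I / 4, -Complex.I / 4, Complex.I / 4, Complex.I / 4] : Fin 4 → ℂ) i *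
      trigMonomial (diagonalModes i) a := by
  rw [sum_diagonalModes]
  push_cast
  rw [Complex.sin, Complex.cos]
  simp
  ring

theorem IsTrigPoly.sin_mul_sin : IsTrigPoly 1 1 (fun a => sin (a 0) * sin (a 1)) :=
  ⟨Fin 4, inferInstance, _, _, sin_mul_sin_eq_sum, fun i j => (abs_diagonalModes i j).le, by
    simp [Fin.sum_univ_four]
    norm_num⟩

theorem IsTrigPoly.cos_mul_cos : IsTrigPoly 1 1 (fun a => cos (a 0) * cos (a 1)) :=
  ⟨Fin 4, inferInstance, _, _, cos_mul_cos_eq_sum, fun i j => (abs_diagonalModes i j).le, by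
    simp [Fin.sum_univ_four]
    norm_num⟩

theorem norm_sq_toLp_two {𝕜 : Type*} [RCLike 𝕜] (x : Fin 2 → 𝕜) :
    ‖(WithLp.toLp 2 x : EuclideanSpace 𝕜 (Fin 2))‖ = √(‖x 0‖ ^ 2 + ‖x 1‖ ^ 2) := by
  rw [EuclideanSpace.norm_eq, Fin.sum_univ_two]

theorem vorticityNorm_velocity : vorticityNorm velocity = 2 := by
  rw [vorticityNorm_eq_sum (k := fun i =>
    2 * (![-Complex.I / 4, -Complex.I / 4, Complex.I / 4, Complex.I / 4] : Fin 4 → ℂ) i)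
    diagonalModes_injective]
  · have h : ∀ i, ‖2 * (![-Complex.I / 4, -Complex.I / 4, Complex.I / 4, Complex.I / 4] :
        Fin 4 → ℂ) i‖ₑ = ENNReal.ofReal (1 / 2) := by
      intro i
      rw [← ofReal_norm]
      congr 1
      fin_cases i <;> simp <;> norm_num
    simp only [h]
    rw [Finset.sum_const, ← ENNReal.ofReal_nsmul]
    norm_num
  · intro a
    rw [vorticity_velocity]
    simp only [mul_assoc]
    rw [← Finset.mul_sum, ← sin_mul_cos_eq_sum]
    push_cast
    ring

theorem gradNorm_velocity : gradNorm velocity = 2 := by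
  rw [gradNorm_eq_sum (k := fun i =>
    ![-(![-1 / 4, 1 / 4, 1 / 4, -1 / 4] : Fin 4 → ℂ) i,
      -(![1 / 4, 1 / 4, 1 / 4, 1 / 4] : Fin 4 → ℂ) i]) diagonalModes_injective]
  -- Each of the four modes has |p| = √2 and a coefficient of length √2/4.
  · have h : ∀ i, ‖(WithLp.toLp 2 fun j => (diagonalModes i j : ℝ) : Plane)‖ₑ *
        ‖(WithLp.toLp 2 ![-(![-1 / 4, 1 / 4, 1 / 4, -1 / 4] : Fin 4 → ℂ) i,
      -(![1 / 4, 1 / 4, 1 / 4, 1 / 4] : Fin 4 → ℂ) i] : EuclideanSpace ℂ (Fin 2))‖ₑ =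
        ENNReal.ofReal (1 / 2) := by
      intro i
      rw [← ofReal_norm, ← ofReal_norm, ← ENNReal.ofReal_mul (norm_nonneg _), norm_sq_toLp_two,
        norm_sq_toLp_two, ← Real.sqrt_mul (by positivity)]
      congr 1
      rw [Real.sqrt_eq_iff_mul_self_eq (by positivity) (by norm_num)]
      fin_cases i <;> simp [diagonalModes] <;> norm_num
    simp only [h]
    rw [Finset.sum_const, ← ENNReal.ofReal_nsmul]
    norm_num
  · intro a j
    fin_cases j
    · simpa [velocity, Finset.sum_neg_distrib] using sin_mul_sin_eq_sum a
    · simpa [velocity, Finset.sum_neg_distrib] using cos_mul_cos_eq_sum a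

/-- The wave vectors `(±2, 0)` and `(0, ±2)`. -/
def axialModes : Fin 4 → Fin 2 → ℤ := ![![2, 0], ![-2, 0], ![0, 2], ![0, -2]]

theorem axialModes_injective : Function.Injective axialModes := by
  decide

theorem gradNorm_sin_two_mul :
    gradNorm (fun a => (1 / 4 : ℝ) • !₂[sin (2 * a 0), -sin (2 * a 1)]) = 1 := by
  rw [gradNorm_eq_sum (q := axialModes) (k := ![![-Complex.I / 8, 0], ![Complex.I / 8, 0],
    ![0, Complex.I / 8], ![0, -Complex.I / 8]]) axialModes_injective]
  -- Each of the four modes has |p| = 2 and a coefficient of length 1/8.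
  · have h : ∀ i, ‖(WithLp.toLp 2 fun j => (axialModes i j : ℝ) : Plane)‖ₑ *
        ‖(WithLp.toLp 2 ((![![-Complex.I / 8, 0], ![Complex.I / 8, 0],
          ![0, Complex.I / 8], ![0, -Complex.I / 8]] : Fin 4 → Fin 2 → ℂ) i) :
          EuclideanSpace ℂ (Fin 2))‖ₑ = ENNReal.ofReal (1 / 4) := by
      intro i
      rw [← ofReal_norm, ← ofReal_norm, ← ENNReal.ofReal_mul (norm_nonneg _), norm_sq_toLp_two,
        norm_sq_toLp_two, ← Real.sqrt_mul (by positivity)]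
      congr 1
      rw [Real.sqrt_eq_iff_mul_self_eq (by positivity) (by norm_num)]
      fin_cases i <;> simp [axialModes] <;> norm_num
    simp only [h]
    rw [Finset.sum_const, ← ENNReal.ofReal_nsmul]
    norm_num
  · intro a j
    fin_cases j
    · simp [Fin.sum_univ_four, axialModes, trigMonomial, Complex.sin]
      ring_nf
    · simp [Fin.sum_univ_four, axialModes, trigMonomial, Complex.sin]
      ring_nf

/-! ### Taylor recursion and gradient bounds -/

/-- The Taylor coefficient of order `n` at `0`. -/
def taylorAt (n : ℕ) (f : ℝ → ℝ) : ℝ := (n ! : ℝ)⁻¹ * iteratedDeriv n f 0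

theorem taylorAt_neg (n : ℕ) (f : ℝ → ℝ) : taylorAt n (fun t => -f t) = -taylorAt n f := by
  rw [taylorAt, taylorAt, iteratedDeriv_fun_neg, mul_neg]

theorem taylorAt_succ {f f' : ℝ → ℝ} (h : ∀ t, HasDerivAt f (f' t) t) (n : ℕ) :
    taylorAt (n + 1) f = ((n + 1 : ℝ))⁻¹ * taylorAt n f' := by
  rw [taylorAt, taylorAt, iteratedDeriv_succ', funext fun t => (h t).deriv, Nat.factorial_succ]
  push_cast
  rw [mul_inv]
  ring

theorem taylorAt_mul {f g : ℝ → ℝ} (hf : ContDiff ℝ ∞ f) (hg : ContDiff ℝ ∞ g) (n : ℕ) :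
    taylorAt n (fun t => f t * g t) =
      ∑ i ∈ Finset.range (n + 1), taylorAt i f * taylorAt (n - i) g := by
  rw [taylorAt, iteratedDeriv_fun_mul (contDiff_infty.1 hf n).contDiffAt (contDiff_infty.1 hg n).contDiffAt,
    Finset.mul_sum]
  refine Finset.sum_congr rfl fun i hi => ?_
  have hi' : i ≤ n := Nat.lt_succ_iff.1 (Finset.mem_range.1 hi)
  rw [taylorAt, taylorAt, Nat.cast_choose ℝ hi']
  have := Nat.factorial_ne_zero n
  field_simp

/-- The quadratic system `S' = -C W`, `C' = S W`, `W' = -S C`, with initial values that are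
trigonometric polynomials of degree and size at most `1`. -/
theorem isTrigPoly_taylorAt_quadratic {S C W : Plane → ℝ → ℝ}
    (hS : ∀ a t, HasDerivAt (S a) (-(C a t * W a t)) t)
    (hC : ∀ a t, HasDerivAt (C a) (S a t * W a t) t)
    (hW : ∀ a t, HasDerivAt (W a) (-(S a t * C a t)) t)
    (sS : ∀ a, ContDiff ℝ ∞ (S a)) (sC : ∀ a, ContDiff ℝ ∞ (C a)) (sW : ∀ a, ContDiff ℝ ∞ (W a))
    (iS : IsTrigPoly 1 1 fun a => S a 0) (iC : IsTrigPoly 1 1 fun a => C a 0)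
    (iW : IsTrigPoly 1 1 fun a => W a 0) (n : ℕ) :
    IsTrigPoly (n + 1) 1 (fun a => taylorAt n (S a)) ∧
    IsTrigPoly (n + 1) 1 (fun a => taylorAt n (C a)) ∧
    IsTrigPoly (n + 1) 1 (fun a => taylorAt n (W a)) := by
  induction n using Nat.strong_induction_on with
  | _ n ih =>
    rcases n with _ | n
    · simpa [taylorAt] using ⟨iS, iC, iW⟩
    have key : ∀ {F G : Plane → ℝ → ℝ}, (∀ a, ContDiff ℝ ∞ (F a)) → (∀ a, ContDiff ℝ ∞ (G a)) →
        (∀ m < n + 1, IsTrigPoly (m + 1) 1 (fun a => taylorAt m (F a))) →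
        (∀ m < n + 1, IsTrigPoly (m + 1) 1 (fun a => taylorAt m (G a))) →
        IsTrigPoly (n + 1 + 1) 1
          (fun a => ((n + 1 : ℝ))⁻¹ * taylorAt n (fun t => F a t * G a t)) := by
      intro F G sF sG hF hG
      simp only [fun a => taylorAt_mul (sF a) (sG a) n]
      -- The Cauchy product has n + 1 terms of size 1 and degree (i + 1) + (n - i + 1) = n + 2. The
      -- factor 1/(n + 1) from time integration offsets their number exactly.
      have h1 := IsTrigPoly.sum_range (n + 1) (d := n + 1 + 1) (M := 1)
        (F := fun i a => taylorAt i (F a) * taylorAt (n - i) (G a)) fun i hi => by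
          have := (hF i hi).mul (hG (n - i) (by omega))
          rw [mul_one] at this
          convert this using 1
          omega
      refine (h1.const_mul ((n + 1 : ℝ))⁻¹).mono ?_
      rw [abs_of_nonneg (by positivity)]
      push_cast
      rw [mul_one, inv_mul_cancel₀ (by positivity)]
    have kS := key sC sW (fun m hm => (ih m hm).2.1) (fun m hm => (ih m hm).2.2)
    have kC := key sS sW (fun m hm => (ih m hm).1) (fun m hm => (ih m hm).2.2)
    have kW := key sS sC (fun m hm => (ih m hm).1) (fun m hm => (ih m hm).2.1)
    simp only [fun a => taylorAt_succ (hS a), fun a => taylorAt_succ (hC a),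
      fun a => taylorAt_succ (hW a), taylorAt_neg, mul_neg]
    exact ⟨kS.neg, kC, kW.neg⟩

theorem isTrigPoly_taylorAt_displacement {x y : Plane → ℝ → ℝ}
    (h : ∀ a, IsTrajectory (x a) (y a))
    (iS : IsTrigPoly 1 1 fun a => sin (x a 0)) (iC : IsTrigPoly 1 1 fun a => cos (x a 0))
    (iW : IsTrigPoly 1 1 fun a => sin (x a 0) * sin (y a 0)) (n : ℕ) :
    IsTrigPoly (n + 1) (n + 1 : ℝ)⁻¹ (fun a => taylorAt (n + 1) (fun t => x a t - x a 0)) := by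
  have hW := (isTrigPoly_taylorAt_quadratic (S := fun a t => sin (x a t))
    (C := fun a t => cos (x a t)) (W := fun a t => sin (x a t) * sin (y a t))
    (fun a => (h a).hasDerivAt_sin) (fun a => (h a).hasDerivAt_cos)
    (fun a => (h a).hasDerivAt_sin_mul_sin) (fun a => (h a).contDiff_pair.1.sin)
    (fun a => (h a).contDiff_pair.1.cos)
    (fun a => (h a).contDiff_pair.1.sin.mul (h a).contDiff_pair.2.sin) iS iC iW n).2.2
  simp only [fun a => taylorAt_succ fun t => ((h a).fst t).sub_const (x a 0), taylorAt_neg]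
  have := hW.neg.const_mul (n + 1 : ℝ)⁻¹
  rwa [abs_of_nonneg (by positivity), mul_one] at this

/-- A wave vector with both entries at most d in modulus has length at most √2 d, and the length of
a vector coefficient is at most the sum of the moduli of its components. -/
theorem gradNorm_le_of_isTrigPoly {f : Plane → Plane} {d : ℕ} {M N : ℝ}
    (h0 : IsTrigPoly d M fun a => f a 0) (h1 : IsTrigPoly d N fun a => f a 1) :
    gradNorm f ≤ ENNReal.ofReal (√2 * d * (M + N)) := by
  let w : (Fin 2 → ℤ) → ℝ≥0∞ := fun p => ‖(WithLp.toLp 2 fun i => (p i : ℝ) : Plane)‖ₑ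
  have hw : ∀ p : Fin 2 → ℤ, (∀ j, |p j| ≤ d) → w p ≤ ENNReal.ofReal (√2 * d) := by
    intro p hp
    simp only [w]
    rw [← ofReal_norm]
    refine ENNReal.ofReal_le_ofReal ?_
    rw [EuclideanSpace.norm_eq, Fin.sum_univ_two]
    refine Real.sqrt_le_iff.2 ⟨by positivity, ?_⟩
    have e : ∀ j, ‖(p j : ℝ)‖ ^ 2 ≤ (d : ℝ) ^ 2 := fun j => by
      have : ‖(p j : ℝ)‖ ≤ d := by
        rw [Real.norm_eq_abs]
        exact_mod_cast hp j
      gcongr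
    have := e 0
    have := e 1
    rw [mul_pow, sq_sqrt (by norm_num)]
    simp only at *
    linarith
  have hs : ∀ {g : Plane → ℝ} {K : ℝ}, IsTrigPoly d K g →
      ∑' p, w p * ‖fourierCoeff (fun a => (g a : ℂ)) p‖ₑ ≤ ENNReal.ofReal (√2 * d * K) := by
    rintro g K ⟨ι, _, q, k, h1, h2, h3⟩
    refine (tsum_mul_fourierCoeff_le h1 w).trans ?_
    calc ∑ i, w (q i) * ‖k i‖ₑ ≤ ∑ i, ENNReal.ofReal (√2 * d) * ENNReal.ofReal ‖k i‖ := by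
          refine Finset.sum_le_sum fun i _ => ?_
          rw [ofReal_norm]
          gcongr
          exact hw _ (h2 i)
      _ = ENNReal.ofReal (√2 * d * ∑ i, ‖k i‖) := by
          rw [← Finset.mul_sum, ENNReal.ofReal_mul (p := √2 * d) (by positivity),
            ENNReal.ofReal_sum_of_nonneg fun _ _ => norm_nonneg _]
      _ ≤ _ := by gcongr
  rw [mul_add, ENNReal.ofReal_add (by have := h0.nonneg; positivity)
    (by have := h1.nonneg; positivity)]
  refine le_trans ?_ (add_le_add (hs h0) (hs h1))
  rw [gradNorm, ← ENNReal.tsum_add]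
  refine ENNReal.tsum_le_tsum fun p => ?_
  rw [← mul_add]
  gcongr
  have e : fourierCoeffVec f p =
      EuclideanSpace.single 0 (fourierCoeff (fun a => (f a 0 : ℂ)) p) +
      EuclideanSpace.single 1 (fourierCoeff (fun a => (f a 1 : ℂ)) p) := by
    ext j
    fin_cases j <;> simp [fourierCoeffVec]
  rw [e]
  refine (enorm_add_le _ _).trans (le_of_eq ?_)
  rw [← ofReal_norm, ← ofReal_norm, PiLp.norm_single,
    PiLp.norm_single, ofReal_norm, ofReal_norm]

namespace IsLagrangianMap

variable {X : Plane → ℝ → Plane}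

theorem taylorCoeff_apply_eq_taylorAt (hX : IsLagrangianMap velocity X) (s : ℕ) (a : Plane)
    (i : Fin 2) : taylorCoeff X s a i = taylorAt s (fun t => X a t i - X a 0 i) := by
  rw [hX.taylorCoeff_apply, taylorAt, (hX a).1]

/-- Degree s + 1 and size 1/(s + 1) cancel, leaving √2 for each of the two coordinates. -/
theorem gradNorm_taylorCoeff_le (hX : IsLagrangianMap velocity X) (s : ℕ) :
    gradNorm (taylorCoeff X (s + 1)) ≤ ENNReal.ofReal (2 * √2) := by
  have h0 := isTrigPoly_taylorAt_displacement hX.isTrajectory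
    (by simpa only [(hX _).1] using IsTrigPoly.sin_coord 0)
    (by simpa only [(hX _).1] using IsTrigPoly.cos_coord 0)
    (by
      simp only [(hX _).1]
      exact IsTrigPoly.sin_mul_sin) s
  have h1 := isTrigPoly_taylorAt_displacement (fun a => (hX.isTrajectory a).swap)
    (by simpa only [(hX _).1, sin_add_pi_div_two] using IsTrigPoly.cos_coord 1)
    (by simpa only [(hX _).1, cos_add_pi_div_two] using (IsTrigPoly.sin_coord 1).neg)
    (by
      simp only [(hX _).1, sin_add_pi_div_two]
      simpa only [mul_comm] using IsTrigPoly.cos_mul_cos) s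
  simp only [add_sub_add_right_eq_sub] at h1
  simp only [← hX.taylorCoeff_apply_eq_taylorAt] at h0 h1
  refine (gradNorm_le_of_isTrigPoly h0 h1).trans (le_of_eq ?_)
  congr 1
  push_cast
  field_simp
  norm_num

theorem taylorCoeff_one (hX : IsLagrangianMap velocity X) : taylorCoeff X 1 = velocity := by
  ext a i
  have h := hX.isTrajectory a
  fin_cases i
  · change taylorCoeff X 1 a 0 = _
    rw [hX.taylorCoeff_apply_eq_taylorAt, taylorAt_succ fun t => (h.fst t).sub_const _]
    simp [taylorAt, (hX a).1, velocity]
  · change taylorCoeff X 1 a 1 = _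
    rw [hX.taylorCoeff_apply_eq_taylorAt, taylorAt_succ fun t => (h.snd t).sub_const _]
    simp [taylorAt, (hX a).1, velocity]

theorem taylorCoeff_two (hX : IsLagrangianMap velocity X) (a : Plane) :
    taylorCoeff X 2 a = (1 / 4 : ℝ) • !₂[sin (2 * a 0), -sin (2 * a 1)] := by
  have h := hX.isTrajectory a
  have h' := h.swap.hasDerivAt_sin_mul_sin
  simp only [sin_add_pi_div_two, cos_add_pi_div_two, mul_comm (cos (X a _ 1))] at h'
  ext i
  fin_cases i
  · change taylorCoeff X 2 a 0 = _
    rw [hX.taylorCoeff_apply_eq_taylorAt, taylorAt_succ fun t => (h.fst t).sub_const _,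
      taylorAt_neg, taylorAt_succ h.hasDerivAt_sin_mul_sin]
    simp [taylorAt, (hX a).1, sin_two_mul]
    ring
  · change taylorCoeff X 2 a 1 = _
    rw [hX.taylorCoeff_apply_eq_taylorAt, taylorAt_succ fun t => (h.snd t).sub_const _,
      taylorAt_neg, taylorAt_succ h']
    simp [taylorAt, (hX a).1, sin_two_mul]
    ring

end IsLagrangianMap

/-! ### The critical time -/

theorem exists_fourthRoot_two : ∃ b : ℝ, 1.1892 < b ∧ b < 1.18921 ∧ √2 = b ^ 2 ∧
    (b ^ 2) ^ 2 = 2 ∧ criticalTime = (2 - b) / (2 * b ^ 2 - 1) := by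
  have hb0 : (0 : ℝ) ≤ (2 : ℝ) ^ (1 / 4 : ℝ) := by positivity
  have hb4 : ((2 : ℝ) ^ (1 / 4 : ℝ)) ^ 4 = 2 := by
    rw [← rpow_natCast, ← rpow_mul (by norm_num)]
    norm_num
  have h8 : √8 = 2 * √2 := by
    rw [show (8 : ℝ) = 2 ^ 2 * 2 by norm_num, sqrt_mul (by positivity), sqrt_sq (by norm_num)]
  have hc : criticalTime = (2 - (2 : ℝ) ^ (1 / 4 : ℝ)) / (√8 - 1) := rfl
  generalize (2 : ℝ) ^ (1 / 4 : ℝ) = b at *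
  have h2 : √2 = b ^ 2 := by
    rw [Real.sqrt_eq_iff_mul_self_eq (by norm_num) (by positivity)]
    linarith
  refine ⟨b, ?_, ?_, h2, by linarith, by rw [hc, h8, h2]⟩
  · exact lt_of_pow_lt_pow_left₀ 4 hb0 (by rw [hb4]; norm_num)
  · exact lt_of_pow_lt_pow_left₀ 4 (by norm_num) (by rw [hb4]; norm_num)

theorem criticalTime_approx : 0.44335 < criticalTime ∧ criticalTime < 0.44345 := by
  obtain ⟨b, h1, h2, -, -, hc⟩ := exists_fourthRoot_two
  have h3 : 1.414196 < b ^ 2 := by nlinarith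
  have h4 : b ^ 2 < 1.414221 := by nlinarith
  rw [hc, lt_div_iff₀ (by linarith), div_lt_iff₀ (by linarith)]
  constructor <;> linarith

theorem one_div_sqrt_two : 1 / √2 = √2 / 2 := by
  rw [div_eq_div_iff (by positivity) (by norm_num)]
  norm_num

theorem timeTerm_eq (T : ℝ) : timeTerm T = T - (2 * √2 - 1) / 4 * T ^ 2 := by
  rw [timeTerm, one_div_sqrt_two]
  ring

/-- The minimum of -z + z²/√2 is -√2/4, at z = √2/2. The critical time is thus where `timeTerm`
first reaches √2/4, the smaller root of a quadratic in T. -/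
theorem timeTerm_criticalTime : timeTerm criticalTime = √2 / 4 := by
  obtain ⟨b, h1, -, h2, h3, hc⟩ := exists_fourthRoot_two
  rw [timeTerm_eq, hc, h2]
  have : 2 * b ^ 2 - 1 ≠ 0 := by nlinarith
  field_simp
  linear_combination -2 * h3

theorem timeTerm_lt {T : ℝ} (h : T < criticalTime) : timeTerm T < √2 / 4 := by
  rw [← timeTerm_criticalTime, timeTerm_eq, timeTerm_eq]
  have := criticalTime_approx.2
  have h2 : √2 < 1.5 := by
    rw [Real.sqrt_lt' (by norm_num)]
    norm_num
  have h1 : 1 ≤ √2 := Real.one_le_sqrt.2 (by norm_num)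
  have : 0 < (criticalTime - T) * (1 - (2 * √2 - 1) / 4 * (T + criticalTime)) := by
    refine mul_pos (by linarith) ?_
    nlinarith
  linarith

theorem isLeast_criticalTime :
    IsLeast {T : ℝ | 0 ≤ T ∧ ∀ z : ℝ, 0 ≤ timeTerm T - z + z ^ 2 / √2} criticalTime := by
  have hs : (√2) ^ 2 = 2 := sq_sqrt (by norm_num)
  have hd : ∀ z : ℝ, z ^ 2 / √2 = √2 / 2 * z ^ 2 := fun z => by
    rw [← one_div_sqrt_two]
    ring
  refine ⟨⟨by linarith [criticalTime_approx.1], fun z => ?_⟩, fun T hT => ?_⟩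
  · rw [timeTerm_criticalTime, hd]
    have : 0 ≤ √2 / 2 * (z - √2 / 2) ^ 2 := by positivity
    linear_combination this - (z / 2 - √2 / 8) * hs
  · by_contra! hlt
    have h1 := timeTerm_lt hlt
    have h2 := hT.2 (√2 / 2)
    rw [hd] at h2
    have : √2 / 2 * (√2 / 2) ^ 2 = √2 / 4 := by
      linear_combination √2 / 8 * hs
    linarith

/-! ### Majorant of the generating function -/

/-- An upper bound of the generating function, in dimensional time. -/
def majorant (t : ℝ) : ℝ := 2 * t + t ^ 2 + 2 * √2 * t ^ 3 / (1 - t)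

/-- Keeps the majorant left of the vertex √2/2. The range t ≤ 1/4 suffices because half the critical
time is below 0.222. -/
theorem majorant_le {t : ℝ} (h0 : 0 ≤ t) (h1 : t ≤ 1 / 4) : majorant t ≤ √2 / 2 := by
  have h2 : √2 < 1.5 := by
    rw [Real.sqrt_lt' (by norm_num)]
    norm_num
  have h3 : 1.4 < √2 := by
    rw [Real.lt_sqrt (by norm_num)]
    norm_num
  have h4 : t ^ 2 ≤ 1 / 16 := by nlinarith
  have h5 : t ^ 3 ≤ 1 / 64 := by nlinarith
  have h6 : 2 * √2 * t ^ 3 / (1 - t) ≤ 1 / 16 := by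
    rw [div_le_iff₀ (by linarith)]
    have : √2 * t ^ 3 ≤ 1.5 * (1 / 64) := by gcongr
    linarith
  rw [majorant]
  linarith

/-- The terms in t and t² cancel because `timeTerm` contains the exact first two coefficients. With
q the tail, q (1 - t) = 2√2 t³ turns the cubic remainder into q t (2√2 - 1) plus nonnegative terms.
-/
theorem quadratic_majorant_nonneg {t : ℝ} (h0 : 0 ≤ t) (h1 : t < 1) :
    0 ≤ timeTerm (2 * t) - majorant t + √2 / 2 * majorant t ^ 2 := by
  rw [timeTerm_eq, majorant]
  have hq0 : 0 ≤ 2 * √2 * t ^ 3 / (1 - t) := div_nonneg (by positivity) (by linarith)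
  have hq : 2 * √2 * t ^ 3 / (1 - t) * (1 - t) = 2 * √2 * t ^ 3 :=
    div_mul_cancel₀ _ (by linarith)
  generalize 2 * √2 * t ^ 3 / (1 - t) = q at *
  have h2 : 1 ≤ √2 := Real.one_le_sqrt.2 (by norm_num)
  have e1 : 0 ≤ q * t * (2 * √2 - 1) := mul_nonneg (by positivity) (by linarith)
  have e2 : 0 ≤ √2 / 2 * (t ^ 4 + 2 * t ^ 2 * q + q ^ 2) := by positivity
  linear_combination e1 + e2 + hq

theorem tsum_le_majorant {g : ℕ → ℝ≥0∞} {t : ℝ} (h0 : 0 ≤ t) (h1 : t < 1) (hg0 : g 0 = 2)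
    (hg1 : g 1 = 1) (hg : ∀ s, g s ≤ ENNReal.ofReal (2 * √2)) :
    ∑' s, g s * ENNReal.ofReal t ^ (s + 1) ≤ ENNReal.ofReal (majorant t) := by
  have hgeo : HasSum (fun s : ℕ => 2 * √2 * t ^ 3 * t ^ s) (2 * √2 * t ^ 3 / (1 - t)) := by
    rw [div_eq_mul_inv]
    exact (hasSum_geometric_of_lt_one h0 h1).mul_left _
  have htail : ∑' s, g (s + 2) * ENNReal.ofReal t ^ (s + 2 + 1) ≤
      ENNReal.ofReal (2 * √2 * t ^ 3 / (1 - t)) := by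
    rw [← hgeo.tsum_eq, ENNReal.ofReal_tsum_of_nonneg (fun s => by positivity) hgeo.summable]
    refine ENNReal.tsum_le_tsum fun s => ?_
    calc g (s + 2) * ENNReal.ofReal t ^ (s + 2 + 1)
        ≤ ENNReal.ofReal (2 * √2) * ENNReal.ofReal t ^ (s + 2 + 1) := mul_le_mul_left (hg _) _
      _ = ENNReal.ofReal (2 * √2 * t ^ (s + 2 + 1)) := by
        rw [ENNReal.ofReal_mul (p := 2 * √2) (by positivity), ENNReal.ofReal_pow h0]
      _ = _ := by
        congr 1
        ring
  have hhead : ∑ s ∈ Finset.range 2, g s * ENNReal.ofReal t ^ (s + 1) =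
      ENNReal.ofReal (2 * t + t ^ 2) := by
    rw [Finset.sum_range_succ, Finset.sum_range_one, hg0, hg1,
      ENNReal.ofReal_add (by positivity) (by positivity), ENNReal.ofReal_mul (by norm_num),
      ENNReal.ofReal_pow h0]
    simp
  have hsplit := Summable.sum_add_tsum_nat_add'
    (f := fun s => g s * ENNReal.ofReal t ^ (s + 1)) (k := 2) ENNReal.summable
  have hq : 0 ≤ 2 * √2 * t ^ 3 / (1 - t) := div_nonneg (by positivity) (by linarith)
  calc ∑' s, g s * ENNReal.ofReal t ^ (s + 1)
      ≤ ENNReal.ofReal (2 * t + t ^ 2) + ENNReal.ofReal (2 * √2 * t ^ 3 / (1 - t)) := by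
        rw [← hsplit]
        exact add_le_add hhead.le htail
    _ = ENNReal.ofReal (majorant t) := (ENNReal.ofReal_add (by positivity) hq).symm

theorem toComplex_apply (x : Plane) (i : Fin 2) : toComplex x i = (x i : ℂ) := rfl

namespace IsLagrangianMap

variable {X : Plane → ℝ → Plane}

theorem genFun_le_majorant (hX : IsLagrangianMap velocity X) {t : ℝ} (h0 : 0 ≤ t) (h1 : t < 1) :
    genFun X t ≤ ENNReal.ofReal (majorant t) := by
  refine tsum_le_majorant h0 h1 ?_ ?_ hX.gradNorm_taylorCoeff_le
  · rw [zero_add, hX.taylorCoeff_one, gradNorm_velocity]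
  · rw [show 1 + 1 = 2 from rfl, show taylorCoeff X 2 = _ from funext hX.taylorCoeff_two,
      gradNorm_sin_two_mul]

theorem genFun_bounds (hX : IsLagrangianMap velocity X) {t : ℝ} (h0 : 0 ≤ t)
    (h1 : 2 * t < criticalTime) :
    genFun X t < ⊤ ∧
      0 ≤ timeTerm (2 * t) - (genFun X t).toReal + (genFun X t).toReal ^ 2 / √2 ∧
      (genFun X t).toReal ≤ (1 - √(1 - 2 * √2 * timeTerm (2 * t))) / √2 := by
  have ht : t ≤ 1 / 4 := by linarith [criticalTime_approx.2]
  have hs : (√2) ^ 2 = 2 := sq_sqrt (by norm_num)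
  have hs0 : 0 < √2 := by positivity
  have hle := hX.genFun_le_majorant h0 (by linarith)
  have hm := majorant_le h0 ht
  have hquad := quadratic_majorant_nonneg h0 (by linarith : t < 1)
  have hm0 : 0 ≤ majorant t := by
    rw [majorant]
    have : 0 ≤ 2 * √2 * t ^ 3 / (1 - t) := div_nonneg (by positivity) (by linarith)
    positivity
  have hle' : (genFun X t).toReal ≤ majorant t :=
    ENNReal.toReal_le_of_le_ofReal hm0 hle
  refine ⟨hle.trans_lt ENNReal.ofReal_lt_top, ?_, hle'.trans ?_⟩
  · generalize (genFun X t).toReal = z at *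
    have e : z ^ 2 / √2 = √2 / 2 * z ^ 2 := by
      rw [← one_div_sqrt_two]
      ring
    rw [e]
    -- This is the value of the quadratic at z minus its value at the majorant, nonnegative since z
    -- ≤ `majorant t` ≤ √2/2.
    have : 0 ≤ √2 / 2 * ((majorant t - z) * (√2 - majorant t - z)) :=
      mul_nonneg (by positivity) (mul_nonneg (by linarith) (by linarith))
    linear_combination this + hquad + (majorant t - z) / 2 * hs
  · rw [le_div_iff₀ hs0]
    -- The majorant lies below the smaller root: the quadratic inequality bounds the discriminant by
    -- (1 - √2 m)², and 1 - √2 m ≥ 0 selects the branch.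
    have : √(1 - 2 * √2 * timeTerm (2 * t)) ≤ 1 - √2 * majorant t := by
      refine Real.sqrt_le_iff.2 ⟨by nlinarith, ?_⟩
      have := mul_nonneg (by positivity : (0 : ℝ) ≤ 2 * √2) hquad
      linear_combination this
    linarith

theorem exists_analytic_displacement (hX : IsLagrangianMap velocity X) (a : Plane) :
    ∃ F : ℂ → EuclideanSpace ℂ (Fin 2),
      AnalyticOnNhd ℂ F (ball 0 (π / 2)) ∧
      (∀ t ∈ ball (0 : ℂ) (π / 2),
        HasSum (fun s : ℕ => t ^ (s + 1) • toComplex (taylorCoeff X (s + 1) a)) (F t)) ∧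
      ∀ t : ℝ, |t| < π / 2 → F t = toComplex (X a t - a) := by
  choose F h1 h2 h3 using hX.exists_holomorphic_coord a
  refine ⟨fun t => WithLp.toLp 2 fun i => F i t, ?_, fun t ht => ?_, fun t ht => ?_⟩
  · refine DifferentiableOn.analyticOnNhd ?_ isOpen_ball
    rw [differentiableOn_euclidean]
    exact h1
  · have h4 : HasSum (fun s : ℕ => fun i => t ^ s * (taylorCoeff X s a i : ℂ))
        (fun i => F i t) := Pi.hasSum.2 fun i => h3 i t ht
    have h5 := h4.mapL ((EuclideanSpace.equiv (Fin 2) ℂ).symm :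
      (Fin 2 → ℂ) →L[ℂ] EuclideanSpace ℂ (Fin 2))
    have h0 : taylorCoeff X 0 a = 0 := by
      simp [taylorCoeff, (hX a).1]
    have h6 : HasSum (fun s : ℕ => t ^ s • toComplex (taylorCoeff X s a))
        (WithLp.toLp 2 fun i => F i t) := h5
    have h7 : t ^ 0 • toComplex (taylorCoeff X 0 a) = 0 := by
      rw [h0]
      ext i
      simp [toComplex_apply]
    -- The displacement vanishes at time 0, so dropping the order-zero term leaves the sum
    -- unchanged.
    have h8 := (hasSum_nat_add_iff' 1).2 h6
    rwa [Finset.sum_range_one, h7, sub_zero] at h8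
  · ext i
    rw [toComplex_apply]
    exact h2 i t ht

end IsLagrangianMap

end ABFlow

end

theorem mainTheorem7 :
    ABFlow.IsSteadyEulerSolution ABFlow.velocity ∧
    -- the numerical value of the critical time, and the sense in which it is critical
    |ABFlow.criticalTime - 0.4434| < 0.00005 ∧
    IsLeast {T : ℝ | 0 ≤ T ∧ ∀ z : ℝ, 0 ≤ ABFlow.timeTerm T - z + z ^ 2 / √2}
      ABFlow.criticalTime ∧
    -- the dimensional constant
    ABFlow.vorticityNorm ABFlow.velocity = 2 ∧
    ∃ X : ABFlow.Plane → ℝ → ABFlow.Plane,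
      ABFlow.IsLagrangianMap ABFlow.velocity X ∧
      (∀ Y, ABFlow.IsLagrangianMap ABFlow.velocity Y → Y = X) ∧
      -- the exact first and second Taylor coefficients and their norms
      (∀ a, ABFlow.taylorCoeff X 1 a =
        !₂[-(sin (a 0) * sin (a 1)), -(cos (a 0) * cos (a 1))]) ∧
      (∀ a, ABFlow.taylorCoeff X 2 a =
        (1 / 4 : ℝ) • !₂[sin (2 * a 0), -sin (2 * a 1)]) ∧
      ABFlow.gradNorm (ABFlow.taylorCoeff X 1) = 2 ∧
      ABFlow.gradNorm (ABFlow.taylorCoeff X 2) = 1 ∧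
      -- the generating function is finite below the critical time, and is bounded there
      (∀ t T : ℝ, 0 ≤ T → T < ABFlow.criticalTime →
        T = (ABFlow.vorticityNorm ABFlow.velocity).toReal * t →
        ABFlow.genFun X t < ⊤ ∧
        0 ≤ ABFlow.timeTerm T - (ABFlow.genFun X t).toReal
          + (ABFlow.genFun X t).toReal ^ 2 / √2 ∧
        (ABFlow.genFun X t).toReal ≤ (1 - √(1 - 2 * √2 * ABFlow.timeTerm T)) / √2) ∧
      -- analyticity in complex time up to the critical time
      (∀ a, ∃ F : ℂ → EuclideanSpace ℂ (Fin 2),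
        AnalyticOnNhd ℂ F
          {t : ℂ | (ABFlow.vorticityNorm ABFlow.velocity).toReal * ‖t‖ < ABFlow.criticalTime} ∧
        (∀ t : ℂ, (ABFlow.vorticityNorm ABFlow.velocity).toReal * ‖t‖ < ABFlow.criticalTime →
          HasSum (fun s : ℕ => t ^ (s + 1) • ABFlow.toComplex (ABFlow.taylorCoeff X (s + 1) a))
            (F t)) ∧
        ∀ t : ℝ, (ABFlow.vorticityNorm ABFlow.velocity).toReal * |t| < ABFlow.criticalTime →
          F t = ABFlow.toComplex (X a t - a)) ∧
      -- the exact dimensionless radius of convergence, the least one over all particles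
      IsLeast (range fun a : ABFlow.Plane =>
          ABFlow.vorticityNorm ABFlow.velocity * (ABFlow.taylorSeries X a).radius)
        (ENNReal.ofReal π) := by
  have hn : (ABFlow.vorticityNorm ABFlow.velocity).toReal = 2 := by
    rw [ABFlow.vorticityNorm_velocity]
    rfl
  obtain ⟨X, hX⟩ := ABFlow.exists_lagrangianMap
  -- The critical time is below π, so the guaranteed disk sits inside the disk of radius π/2 in
  -- dimensional time.
  have hball : ∀ {t : ℂ}, 2 * ‖t‖ < ABFlow.criticalTime → t ∈ ball (0 : ℂ) (π / 2) := by
    intro t ht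
    rw [mem_ball_zero_iff]
    linarith [ABFlow.criticalTime_approx.2, pi_gt_three]
  have hr : ∀ r : ℝ≥0∞, ABFlow.vorticityNorm ABFlow.velocity * r = 2 * r := fun r => by
    rw [ABFlow.vorticityNorm_velocity]
  have hpi : ENNReal.ofReal π = 2 * ENNReal.ofReal (π / 2) := by
    rw [← ENNReal.ofReal_ofNat, ← ENNReal.ofReal_mul (by norm_num)]
    congr 1
    ring
  refine ⟨ABFlow.isSteadyEulerSolution_velocity, ?_, ABFlow.isLeast_criticalTime,
    ABFlow.vorticityNorm_velocity, X, hX, fun Y hY => ABFlow.lagrangianMap_unique hX hY,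
    fun a => by rw [hX.taylorCoeff_one]; rfl, hX.taylorCoeff_two, ?_, ?_, ?_, fun a => ?_, ?_⟩
  · have := ABFlow.criticalTime_approx
    rw [abs_lt]
    constructor <;> linarith
  · rw [hX.taylorCoeff_one, ABFlow.gradNorm_velocity]
  · rw [show ABFlow.taylorCoeff X 2 = _ from funext hX.taylorCoeff_two,
      ABFlow.gradNorm_sin_two_mul]
  · intro t T h0 h1 hT
    rw [hn] at hT
    subst hT
    exact hX.genFun_bounds (by linarith) h1
  · simp only [hn]
    obtain ⟨F, h1, h2, h3⟩ := hX.exists_analytic_displacement a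
    refine ⟨F, h1.mono fun t ht => hball ht, fun t ht => h2 t (hball ht), fun t ht => h3 t ?_⟩
    linarith [ABFlow.criticalTime_approx.2, pi_gt_three]
  · simp only [hr, hpi]
    refine ⟨⟨!₂[π / 2, -(π / 2)], ?_⟩, ?_⟩
    · exact congrArg (2 * ·) (le_antisymm hX.radius_separatrix_le (hX.le_radius _))
    · rintro _ ⟨a, rfl⟩
      exact mul_le_mul_right (hX.le_radius a) 2
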